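/- Let $\mathbb F_q$ be a finite field with $q\equiv 1\pmod 4$ elements and put $t=\frac{q-1}{4}$. Multiplicative characters of $\mathbb F_q$ take values in a fixed algebraically closed field of characteristic $0$ (for instance $\mathbb C$ or $\mathbb C_p$); every character $\chi$, including the trivial character $\epsilon$, is extended by $\chi(0)=0$. Let $T$ be a generator of the character group $\widehat{\mathbb F_q^{\times}}$. For characters $A,B$ put $$\binom{A}{B}=\frac{B(-1)}{q}\sum_{x\in\mathbb F_q}A(x)\overline B(1-x),\qquad \overline B=B^{-1},$$ and for characters $A_0,\dots,A_n,B_1,\dots,B_n$ and $x\in\mathbb F_q$ let $${}_{n+1}F_n\left(\left.\begin{array}{cccc}A_0&A_1&\ldots&A_n\\ {}&B_1&\ldots&B_n\end{array}\right|x\right)_q=\frac{q}{q-1}\sum_{\chi}\binom{A_0\chi}{\chi}\binom{A_1\chi}{B_1\chi}\cdots\binom{A_n\chi}{B_n\chi}\chi(x)$$ be Greene's hypergeometric function, the sum being over all characters $\chi$ of $\mathbb F_q^\times$. For $\lambda\in\mathbb F_q$ let $\#X^4_\lambda(\mathbb F_q)$ be the number of points in $\mathbb P^3(\mathbb F_q)$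 of $$X_\lambda^4:\quad x_1^4+x_2^4+x_3^4+x_4^4=4\lambda x_1x_2x_3x_4 .$$ If $\lambda^4=1$, then $$\#X_{\lambda}^4(\mathbb F_q)=\frac{q^3-1}{q-1}+3q\,T^t(-1)+q^2\,{}_{3}F_{2}\left(\left.\begin{array}{ccc}T^t&T^{2t}&T^{3t}\\ {}&\epsilon&\epsilon\end{array}\right|1\right)_q.$$ More generally, if $\lambda\neq 0$, then $$\begin{aligned}\#X_{\lambda}^4(\mathbb F_q)={}&\frac{q^3-1}{q-1}+12q\,T^t(-1)\,T^{2t}(1-\lambda^4)+q^2\,{}_{3}F_{2}\left(\left.\begin{array}{ccc}T^t&T^{2t}&T^{3t}\\ {}&\epsilon&\epsilon\end{array}\right|\frac{1}{\lambda^4}\right)_q\\&+3q^2\binom{T^{3t}}{T^t}\,{}_{2}F_{1}\left(\left.\begin{array}{cc}T^{3t}&T^{t}\\ {}&T^{2t}\end{array}\right|\frac{1}{\lambda^4}\right)_q.\end{aligned}$$ In particular, this applies to the reduction in $\mathbb F_q$ of a rational number $\lambda\neq0$ whose numerator and denominator are prime to $q$. -/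

import Mathlib

open scoped LinearAlgebra.Projectivization

noncomputable section

/-- The quartic form `x₁⁴ + x₂⁴ + x₃⁴ + x₄⁴ - 4 lam x₁ x₂ x₃ x₄` cutting out the Dwork K3 surface. -/
def dworkQuartic {F : Type*} [Field F] (lam : F) : MvPolynomial (Fin 4) F :=
  (∑ i, MvPolynomial.X i ^ 4) - MvPolynomial.C (4 * lam) * ∏ i, MvPolynomial.X i

theorem eval_dworkQuartic {F : Type*} [Field F] (lam : F) (v : Fin 4 → F) :
    MvPolynomial.eval v (dworkQuartic lam) = ∑ i, v i ^ 4 - 4 * lam * ∏ i, v i := by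
  simp [dworkQuartic]

/-- The set of `F`-rational points, in `ℙ³(F)`, of the projective surface
`x₁⁴ + x₂⁴ + x₃⁴ + x₄⁴ = 4 lam x₁ x₂ x₃ x₄`. -/
def dworkPoints {F : Type*} [Field F] (lam : F) : Set (ℙ F (Fin 4 → F)) :=
  {P | MvPolynomial.eval P.rep (dworkQuartic lam) = 0}

/-- Membership does not depend on the choice of homogeneous coordinates. -/
theorem mk_mem_dworkPoints_iff {F : Type*} [Field F] (lam : F) (v : Fin 4 → F) (hv : v ≠ 0) :
    Projectivization.mk F v hv ∈ dworkPoints lam ↔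
      ∑ i, v i ^ 4 = 4 * lam * ∏ i, v i := by
  obtain ⟨a, ha⟩ := Projectivization.exists_smul_eq_mk_rep F v hv
  have key : MvPolynomial.eval (a • v) (dworkQuartic lam) =
      (a : F) ^ 4 * (∑ i, v i ^ 4 - 4 * lam * ∏ i, v i) := by
    rw [eval_dworkQuartic]
    simp only [Fin.sum_univ_four, Fin.prod_univ_four, Pi.smul_apply, Units.smul_def, smul_eq_mul]
    ring
  simp only [dworkPoints, Set.mem_ofPred_eq]
  rw [← ha, key, mul_eq_zero, sub_eq_zero]
  simp

/-- Greene's normalized Jacobi sum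
`binom(A, B) = (B(-1) / q) ∑ x, A(x) B⁻¹(1 - x)`. A multiplicative character (also the trivial
one) takes the value `0` at `0`, which is built into `MulChar`. -/
def greeneBinom {F K : Type*} [Field F] [Fintype F] [Field K] (A B : MulChar F K) : K :=
  B (-1) / (Fintype.card F : K) * jacobiSum A B⁻¹

/-- Greene's finite field hypergeometric function `ₙ₊₁Fₙ(A₀, …, Aₙ; B₁, …, Bₙ | x)_q`:
`q / (q - 1) ∑_χ binom(A₀ χ, χ) binom(A₁ χ, B₁ χ) ⋯ binom(Aₙ χ, Bₙ χ) χ(x)`,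
the sum being over all multiplicative characters `χ` of `F`. -/
def greeneHyp {F K : Type*} [Field F] [Fintype F] [Field K] {n : ℕ}
    (A : Fin (n + 1) → MulChar F K) (B : Fin n → MulChar F K) (x : F) : K :=
  letI : Fintype (MulChar F K) := Fintype.ofFinite _
  (Fintype.card F : K) / ((Fintype.card F : K) - 1) *
    ∑ χ : MulChar F K, greeneBinom (A 0 * χ) χ *
      (∏ i : Fin n, greeneBinom (A i.succ * χ) (B i * χ)) * χ x

end

open Finset

/-! ### Sums over the units of a finite field. -/

section DworkSurface

set_option linter.unusedSectionVars false

variable {F K : Type*} [Field F] [Fintype F] [DecidableEq F] [Field K]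

/-! Write `ψ` for `T ^ t`, of order 4, `φ = ψ ^ 2`, g for Gauss sums and q for the cardinality of
`F`. The affine cone is stratified by the vanishing coordinates. If some coordinate is zero the
equation is diagonal, and these strata give Jacobi sums of powers of `ψ` (`sum_dwork_eq`,
`sum_units_one_add_pow_four_add_pow_four`).

On the torus, scale the first coordinate to 1 and take w, the product of the other three, as a
variable. Two of the remaining coordinates then enter only through their fourth powers, so expanding
over the characters `ψ ^ i`, `ψ ^ j` gives 16 twisted sums over abcd = 1, a + b + c + d = 4λ
(`sum_units_eq_sum_torusSum`). Permuting the characters, or multiplying all four by `ψ`, changes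
nothing, so only three sums remain, with multiplicities 1, 3, 12
(`sum_torusSum_of_orderOf_eq_four`).

Detecting both conditions by characters turns each sum into a sum over `χ` of five Gauss sums
(`torusSum_eq_gaussSum`). Hasse–Davenport splits the fifth, g(χ⁻⁴), and the reflection formula
g(χ)g(χ⁻¹) = χ(-1)q cancels pairs, up to corrections at finitely many `χ`. The class (1,1,1,1)
becomes the ₃F₂ and (1,1,φ,φ) the ₂F₁ (`torusSum_one_eq_greeneHyp`, `torusSum_sq_eq_greeneHyp`). For
(ψ,ψ³,1,1) a sum with a closed form remains, giving φ(1 - λ⁴) (`torusSum_cube_eq_gaussSum`); its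
corrections g(ψ)² and g(ψ³)² cancel the Jacobi sums of the coordinate planes.

When λ⁴ = 1 the φ-term vanishes and the ₂F₁ at 1 is evaluated explicitly
(`greeneBinom_mul_greeneHyp_two_one_one`). -/

theorem sum_eq_zero_add_sum_units {M : Type*} [AddCommMonoid M] (f : F → M) :
    ∑ x, f x = f 0 + ∑ x : Fˣ, f x := by
  classical
  rw [← Finset.add_sum_erase _ _ (mem_univ (0 : F))]
  congr 1
  refine (Finset.sum_bij (fun (u : Fˣ) _ => (u : F)) ?_ ?_ ?_ ?_).symm
  · simp
  · intro a _ b _ h; exact Units.ext h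
  · intro b hb; exact ⟨Units.mk0 b (by simpa using hb), by simp, by simp⟩
  · simp

theorem MulChar.sum_units_eq (χ : MulChar F K) (f : F → K) :
    ∑ x, χ x * f x = ∑ x : Fˣ, χ x * f x := by
  rw [sum_eq_zero_add_sum_units]; simp

theorem MulChar.inv_apply_units (χ : MulChar F K) (a : Fˣ) : χ⁻¹ a = (χ a)⁻¹ :=
  MulChar.inv_apply_eq_inv' χ a

theorem cast_card_ne_zero [CharZero K] : (Fintype.card F : K) ≠ 0 := by
  exact_mod_cast Fintype.card_ne_zero

theorem cast_card_sub_one_ne_zero [CharZero K] : (Fintype.card F : K) - 1 ≠ 0 := by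
  rw [sub_ne_zero]; exact_mod_cast (Fintype.one_lt_card (α := F)).ne'

theorem cast_card_units : (Fintype.card Fˣ : K) = (Fintype.card F : K) - 1 := by
  rw [Fintype.card_units, Nat.cast_sub Fintype.card_pos, Nat.cast_one]

/-! ### Orthogonality of characters and sums over n-th powers. -/

section Orthogonality

variable [IsAlgClosed K] [CharZero K]

theorem MulChar.card_eq_card_sub_one : Nat.card (MulChar F K) = Fintype.card F - 1 := by
  classical
  rw [MulChar.card_eq_card_units_of_hasEnoughRootsOfUnity, Nat.card_eq_fintype_card,
    Fintype.card_units]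

variable [Fintype (MulChar F K)]

theorem MulChar.sum_apply_units (a : Fˣ) :
    ∑ χ : MulChar F K, χ a = if a = 1 then (Fintype.card F : K) - 1 else 0 := by
  split_ifs with h
  · subst h
    simp only [Units.val_one, map_one, sum_const, card_univ, nsmul_eq_mul, mul_one]
    rw [← Nat.card_eq_fintype_card, MulChar.card_eq_card_sub_one,
      Nat.cast_sub Fintype.card_pos, Nat.cast_one]
  · obtain ⟨ρ, hρ⟩ := MulChar.exists_apply_ne_one_of_hasEnoughRootsOfUnity F K
      (a := (a : F)) (by simpa using h)
    refine eq_zero_of_mul_eq_self_left hρ ?_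
    rw [Finset.mul_sum, ← (Group.mulLeft_bijective ρ).sum_comp (fun χ : MulChar F K => χ a)]
    simp

/-- A power sum over the units, expanded over the characters killed by the exponent. -/
theorem sum_units_pow [DecidableEq (MulChar F K)] (n : ℕ) (f : Fˣ → K) :
    ∑ b : Fˣ, f (b ^ n) = ∑ y : Fˣ, f y * ∑ χ : MulChar F K with χ ^ n = 1, χ y := by
  have hq := cast_card_sub_one_ne_zero (F := F) (K := K)
  -- Both sides come from the double sum of χ(y)χ(b)⁻ⁿ: summing over `χ` first detects bⁿ = y,
  -- summing over `b` first detects χⁿ = 1.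
  have key : ∀ y : Fˣ, ((Fintype.card F : K) - 1) * ∑ χ : MulChar F K with χ ^ n = 1, χ y =
      ∑ b : Fˣ, if b ^ n = y then (Fintype.card F : K) - 1 else 0 := by
    intro y
    have h1 : ∀ b : Fˣ, (if b ^ n = y then (Fintype.card F : K) - 1 else 0) =
        ∑ χ : MulChar F K, χ y * (χ ^ n)⁻¹ b := by
      intro b
      have := MulChar.sum_apply_units (K := K) (y * (b ^ n)⁻¹)
      simp only [mul_inv_eq_one, eq_comm (a := y)] at this
      rw [← this]
      refine Finset.sum_congr rfl fun χ _ => ?_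
      rw [Units.val_mul, map_mul, MulChar.inv_apply_units, MulChar.pow_apply_coe,
        Units.val_inv_eq_inv_val, ← MulChar.inv_apply', MulChar.inv_apply_units,
        Units.val_pow_eq_pow_val, map_pow]
    simp only [h1]
    rw [Finset.sum_comm, Finset.mul_sum, Finset.sum_filter]
    refine Finset.sum_congr rfl fun χ _ => ?_
    rw [← Finset.mul_sum]
    have h2 := MulChar.sum_units_eq (χ ^ n)⁻¹ (fun _ => (1 : K))
    simp only [mul_one] at h2
    rw [← h2]
    split_ifs with h
    · rw [h, inv_one, MulChar.sum_one_eq_card_units, cast_card_units, mul_comm]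
    · rw [MulChar.sum_eq_zero_of_ne_one (by simpa using h), mul_zero]
  have h3 : ∀ y : Fˣ, ∑ χ : MulChar F K with χ ^ n = 1, χ y =
      ∑ b : Fˣ, if b ^ n = y then (1 : K) else 0 := by
    intro y
    apply mul_left_cancel₀ hq
    rw [key, Finset.mul_sum]
    simp
  simp only [h3, Finset.mul_sum]
  rw [Finset.sum_comm]
  simp

/-- The character group is cyclic, so it has at most `n` elements killed by `n`, and the powers of
`ρ` already supply `n` of them. -/
theorem MulChar.filter_pow_eq_one [DecidableEq (MulChar F K)] {ρ : MulChar F K} {n : ℕ}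
    (hn : 0 < n) (hρ : orderOf ρ = n) :
    ({χ : MulChar F K | χ ^ n = 1} : Finset (MulChar F K)) = (range n).image (ρ ^ ·) := by
  classical
  have : IsCyclic (MulChar F K) := by
    obtain ⟨e⟩ := MulChar.mulEquiv_units F K
    exact isCyclic_of_surjective e.symm e.symm.surjective
  symm
  refine Finset.eq_of_subset_of_card_le ?_ ?_
  · intro χ
    simp only [mem_image, mem_filter, mem_univ, true_and]
    rintro ⟨i, -, rfl⟩
    rw [← pow_mul, mul_comm, pow_mul, ← hρ, pow_orderOf_eq_one, one_pow]
  · rw [Finset.card_image_of_injOn, card_range]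
    · exact IsCyclic.card_pow_eq_one_le hn
    · intro i hi j hj h
      simp only [coe_range, Set.mem_Iio] at hi hj
      exact pow_injOn_Iio_orderOf (by simpa [hρ] using hi) (by simpa [hρ] using hj) h

theorem sum_units_pow_orderOf {ρ : MulChar F K} {n : ℕ} (hn : 0 < n)
    (hρ : orderOf ρ = n) (f : Fˣ → K) :
    ∑ b : Fˣ, f (b ^ n) = ∑ y : Fˣ, f y * ∑ i ∈ range n, (ρ ^ i) y := by
  classical
  have := sum_units_pow (K := K) n f
  rw [MulChar.filter_pow_eq_one hn hρ] at this
  convert this using 3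
  rw [Finset.sum_image]
  intro i hi j hj h
  simp only [coe_range, Set.mem_Iio] at hi hj
  exact pow_injOn_Iio_orderOf (by simpa [hρ] using hi) (by simpa [hρ] using hj) h

end Orthogonality

/-! ### Gauss sums, Jacobi sums and Greene's binomials. -/

section GaussSums

theorem MulChar.apply_neg_one_mul_self (χ : MulChar F K) : χ (-1) * χ (-1) = 1 := by
  rw [← map_mul]; simp

theorem MulChar.inv_apply_neg_one (χ : MulChar F K) : χ⁻¹ (-1) = χ (-1) := by
  rw [MulChar.inv_apply']; simp

variable {e : AddChar F K}

theorem gaussSum_eq_sum_units (χ : MulChar F K) (e : AddChar F K) :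
    gaussSum χ e = ∑ u : Fˣ, χ u * e u := by
  rw [gaussSum, MulChar.sum_units_eq χ fun x => e x]

theorem sum_units_mul_addChar_mul (χ : MulChar F K) (e : AddChar F K) (a : Fˣ) :
    ∑ u : Fˣ, χ u * e (a * u) = χ⁻¹ a * gaussSum χ e := by
  rw [← gaussSum_mulShift_eq, gaussSum_eq_sum_units]
  simp [AddChar.mulShift_apply]

theorem gaussSum_one_of_isPrimitive (he : e.IsPrimitive) :
    gaussSum (1 : MulChar F K) e = -1 := by
  refine gaussSum_one_left ?_
  have := he one_ne_zero
  rwa [AddChar.mulShift_one] at this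

theorem gaussSum_mul_gaussSum_inv_of_ne_one (he : e.IsPrimitive) {χ : MulChar F K} (hχ : χ ≠ 1) :
    gaussSum χ e * gaussSum χ⁻¹ e = χ (-1) * Fintype.card F := by
  rw [← gaussSum_mul_gaussSum_eq_card hχ he, ← mul_gaussSum_inv_eq_gaussSum χ⁻¹ e,
    MulChar.inv_apply_neg_one]
  ring

theorem gaussSum_mul_gaussSum_inv [DecidableEq (MulChar F K)] (he : e.IsPrimitive)
    (χ : MulChar F K) :
    gaussSum χ e * gaussSum χ⁻¹ e =
      χ (-1) * (Fintype.card F - if χ = 1 then (Fintype.card F : K) - 1 else 0) := by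
  split_ifs with h
  · rw [h, inv_one, gaussSum_one_of_isPrimitive he, MulChar.one_apply (by simp)]
    ring
  · rw [gaussSum_mul_gaussSum_inv_of_ne_one he h, sub_zero]

theorem gaussSum_ne_zero [CharZero K] (he : e.IsPrimitive) (χ : MulChar F K) :
    gaussSum χ e ≠ 0 := by
  by_cases h : χ = 1
  · rw [h, gaussSum_one_of_isPrimitive he]; simp
  · exact gaussSum_ne_zero_of_nontrivial cast_card_ne_zero h he

/-- Replacing division by g(AB) with multiplication by g((AB)⁻¹) makes one formula cover AB = 1 as
well; only the doubly trivial pair is lost. -/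
theorem jacobiSum_mul_card (he : e.IsPrimitive) {A B : MulChar F K} (h : ¬(A = 1 ∧ B = 1)) :
    jacobiSum A B * Fintype.card F =
      (A * B) (-1) * gaussSum A e * gaussSum B e * gaussSum (A * B)⁻¹ e := by
  by_cases hAB : A * B = 1
  · have hA : A ≠ 1 := by
      rintro rfl
      exact h ⟨rfl, by simpa using hAB⟩
    obtain rfl : B = A⁻¹ := (inv_eq_of_mul_eq_one_right hAB).symm
    rw [hAB, jacobiSum_nontrivial_inv hA, inv_one, gaussSum_one_of_isPrimitive he,
      MulChar.one_apply (by simp), one_mul, gaussSum_mul_gaussSum_inv_of_ne_one he hA]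
    ring
  · have h1 := jacobiSum_mul_nontrivial hAB e
    have h2 := gaussSum_mul_gaussSum_inv_of_ne_one he hAB
    have h3 := (A * B).apply_neg_one_mul_self
    linear_combination ((A * B) (-1) * gaussSum (A * B)⁻¹ e) * h1
      - jacobiSum A B * (A * B) (-1) * h2 - jacobiSum A B * Fintype.card F * h3

theorem greeneBinom_eq_gaussSum [CharZero K] (he : e.IsPrimitive) {A B : MulChar F K}
    (h : ¬(A = 1 ∧ B = 1)) :
    greeneBinom A B = A (-1) / (Fintype.card F : K) ^ 2 *
      (gaussSum A e * gaussSum B⁻¹ e * gaussSum (A⁻¹ * B) e) := by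
  have hq := cast_card_ne_zero (F := F) (K := K)
  have h1 := jacobiSum_mul_card he (A := A) (B := B⁻¹) (by simpa using h)
  rw [MulChar.mul_apply, MulChar.inv_apply_neg_one, mul_inv, inv_inv] at h1
  rw [greeneBinom]
  field_simp
  have h3 := B.apply_neg_one_mul_self
  linear_combination B (-1) * h1 + A (-1) * gaussSum A e * gaussSum B⁻¹ e * gaussSum (A⁻¹ * B) e * h3

/-! ### Hasse–Davenport for the quadratic character. -/

section Duplication

variable [IsAlgClosed K] [CharZero K]

theorem two_ne_zero_of_orderOf_eq_two {φ : MulChar F K} (hφ : orderOf φ = 2) : (2 : F) ≠ 0 := by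
  have h := φ.orderOf_dvd_card_sub_one
  rw [hφ] at h
  intro h2
  have h3 : ringChar F = 2 := CharP.ringChar_of_prime_eq_zero Nat.prime_two (by exact_mod_cast h2)
  have h4 := FiniteField.even_card_of_char_two h3
  have := Fintype.one_lt_card (α := F)
  omega

/-- The substitution y = 2x - 1 turns 4x(1 - x) into 1 - y², and a nonzero z has 1 + φ(z) square
roots. -/
theorem apply_four_mul_jacobiSum_self {φ χ : MulChar F K} (hφ : orderOf φ = 2) (hχ : χ ≠ 1) :
    χ 4 * jacobiSum χ χ = jacobiSum χ φ := by
  have := Fintype.ofFinite (MulChar F K)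
  have h2 : (2 : F) ≠ 0 := two_ne_zero_of_orderOf_eq_two hφ
  have h1 : χ 4 * jacobiSum χ χ = ∑ y, χ (1 - y ^ 2) := by
    rw [jacobiSum, Finset.mul_sum]
    let E : F ≃ F := (Equiv.mulLeft₀ 2 h2).trans (Equiv.subRight 1)
    rw [← E.sum_comp fun y => χ (1 - y ^ 2)]
    refine Finset.sum_congr rfl fun x _ => ?_
    rw [← map_mul, ← map_mul]
    change _ = χ (1 - (2 * x - 1) ^ 2)
    congr 1
    ring
  have h3 := sum_units_pow_orderOf (by norm_num) hφ (fun b : Fˣ => χ (1 - b))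
  have h4 : ∑ y : F, χ (1 - y) = 0 := by
    rw [← MulChar.sum_eq_zero_of_ne_one hχ, ← (Equiv.subLeft (1 : F)).sum_comp χ]
    rfl
  rw [sum_eq_zero_add_sum_units] at h4
  rw [h1, sum_eq_zero_add_sum_units, jacobiSum_comm, jacobiSum,
    φ.sum_units_eq fun x => χ (1 - x)]
  simp only [sum_range_succ, sum_range_zero, zero_add, pow_zero, pow_one,
    MulChar.one_apply_coe, Units.val_pow_eq_pow_val] at h3
  rw [h3]
  simp only [mul_add, mul_one, sum_add_distrib]
  simp only [mul_comm (φ _)]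
  simp only [ne_eq, OfNat.ofNat_ne_zero, not_false_eq_true, zero_pow, sub_zero] at h4 ⊢
  linear_combination h4

/-- The Hasse–Davenport product formula for the quadratic character. -/
theorem gaussSum_duplication (he : e.IsPrimitive) {φ : MulChar F K} (hφ : orderOf φ = 2)
    (χ : MulChar F K) :
    χ 4 * (gaussSum χ e * gaussSum (χ * φ) e) = gaussSum (χ ^ 2) e * gaussSum φ e := by
  have hφ2 : φ * φ = 1 := by rw [← pow_two, ← hφ, pow_orderOf_eq_one]
  have h2 : (2 : F) ≠ 0 := two_ne_zero_of_orderOf_eq_two hφ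
  have h4 : (4 : F) = ((Units.mk0 2 h2) ^ 2 : Fˣ) := by push_cast; norm_num
  -- If χ² = 1 then `χ` is 1 or `φ` and the identity is trivial; otherwise every Jacobi sum below is
  -- a quotient of Gauss sums.
  by_cases h1 : χ ^ 2 = 1
  · have h5 : χ 4 = 1 := by
      rw [h4, Units.val_pow_eq_pow_val, map_pow, ← MulChar.pow_apply_coe, h1, MulChar.one_apply_coe]
    have := Fintype.ofFinite (MulChar F K)
    classical
    have h6 : χ ∈ ({χ : MulChar F K | χ ^ 2 = 1} : Finset (MulChar F K)) := by simpa using h1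
    rw [MulChar.filter_pow_eq_one (by norm_num) hφ] at h6
    simp only [range_add_one, range_zero, image_insert, pow_one, pow_zero, mem_insert,
      insert_empty_eq, image_singleton, mem_singleton] at h6
    rw [h5, h1]
    rcases h6 with rfl | rfl
    · rw [hφ2]; ring
    · simp
  · have hχ : χ ≠ 1 := by rintro rfl; simp at h1
    have hχφ : χ * φ ≠ 1 := by
      intro h
      apply h1
      have : χ = φ := by rw [eq_inv_of_mul_eq_one_left h]; exact inv_eq_of_mul_eq_one_right hφ2
      rw [this, pow_two, hφ2]
    have j1 := jacobiSum_mul_nontrivial (χ := χ) (φ := χ) (by rwa [← pow_two]) e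
    have j2 := jacobiSum_mul_nontrivial hχφ e
    have j3 := apply_four_mul_jacobiSum_self hφ hχ
    rw [← pow_two χ] at j1
    apply mul_left_cancel₀ (gaussSum_ne_zero he χ)
    linear_combination -(χ 4) * gaussSum (χ * φ) e * j1 + gaussSum (χ ^ 2) e * j2
      + gaussSum (χ ^ 2) e * gaussSum (χ * φ) e * j3

end Duplication

end GaussSums

/-! ### Quartic characters and Hasse–Davenport of order four. -/

section Quartic

theorem orderOf_sq_of_orderOf_eq_four {G : Type*} [Group G] {x : G} (hx : orderOf x = 4) :
    orderOf (x ^ 2) = 2 := by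
  rw [orderOf_pow' x two_ne_zero, hx]; rfl

theorem MulChar.apply_pow_units (χ : MulChar F K) (a : Fˣ) (n : ℕ) :
    χ ((a : F) ^ n) = (χ ^ n) a := by
  rw [map_pow, MulChar.pow_apply_coe]

theorem pow_four_of_orderOf_eq_four {ψ : MulChar F K} (hψ : orderOf ψ = 4) : ψ ^ 4 = 1 := by
  rw [← hψ, pow_orderOf_eq_one]

theorem ne_one_of_orderOf_eq_four {ψ : MulChar F K} (hψ : orderOf ψ = 4) : ψ ≠ 1 := by
  rintro rfl; simp at hψ

theorem sq_apply_neg_one (ψ : MulChar F K) : (ψ ^ 2) (-1) = 1 := by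
  rw [pow_two, MulChar.mul_apply, MulChar.apply_neg_one_mul_self]

/-- With i² = -1 in `F` one has -4 = (1 + i)⁴, so `ψ` is 1 at -4. -/
theorem MulChar.apply_four_of_orderOf_eq_four {ψ : MulChar F K} (hψ : orderOf ψ = 4) :
    ψ 4 = ψ (-1) := by
  have h := ψ.orderOf_dvd_card_sub_one
  rw [hψ] at h
  have hq := Fintype.one_lt_card (α := F)
  have h4 : Fintype.card F % 4 = 1 := by omega
  obtain ⟨i, hi⟩ := FiniteField.isSquare_neg_one_iff.mpr (by omega : Fintype.card F % 4 ≠ 3)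
  have h2 : (2 : F) ≠ 0 := by
    intro h2
    have h3 : ringChar F = 2 := CharP.ringChar_of_prime_eq_zero Nat.prime_two (by exact_mod_cast h2)
    have := FiniteField.even_card_of_char_two h3
    omega
  have h1 : (1 + i) ≠ 0 := by
    intro h
    apply h2
    linear_combination (1 - i) * h - hi
  have h5 : (-4 : F) = (Units.mk0 (1 + i) h1 : F) ^ 4 := by
    rw [Units.val_mk0]
    linear_combination (4 * i + i ^ 2 + 5) * hi
  have h6 : ψ (-4) = 1 := by
    rw [h5, MulChar.apply_pow_units, pow_four_of_orderOf_eq_four hψ, MulChar.one_apply_coe]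
  rw [show (-4 : F) = (-1) * 4 by ring, map_mul] at h6
  linear_combination ψ (-1) * h6 - ψ 4 * ψ.apply_neg_one_mul_self

variable {e : AddChar F K} [IsAlgClosed K] [CharZero K]

theorem gaussSum_sq_of_orderOf_eq_four (he : e.IsPrimitive) {ψ : MulChar F K}
    (hψ : orderOf ψ = 4) : gaussSum (ψ ^ 2) e * gaussSum (ψ ^ 2) e = Fintype.card F := by
  have h2 := orderOf_sq_of_orderOf_eq_four hψ
  have h : ψ ^ 2 ≠ 1 := by intro h; rw [h] at h2; simp at h2
  have h3 := gaussSum_mul_gaussSum_inv_of_ne_one he h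
  rw [sq_apply_neg_one, one_mul] at h3
  rwa [inv_eq_of_mul_eq_one_right (a := ψ ^ 2) (b := ψ ^ 2)
    (by rw [← pow_add]; exact pow_four_of_orderOf_eq_four hψ)] at h3

theorem gaussSum_mul_gaussSum_cube (he : e.IsPrimitive) {ψ : MulChar F K}
    (hψ : orderOf ψ = 4) : gaussSum ψ e * gaussSum (ψ ^ 3) e = ψ (-1) * Fintype.card F := by
  rw [← gaussSum_mul_gaussSum_inv_of_ne_one he (ne_one_of_orderOf_eq_four hψ),
    inv_eq_of_mul_eq_one_right (a := ψ) (b := ψ ^ 3)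
    (by rw [← pow_succ']; exact pow_four_of_orderOf_eq_four hψ)]

/-- The Hasse–Davenport product formula for a quartic character. -/
theorem gaussSum_quadruplication (he : e.IsPrimitive) {ψ : MulChar F K} (hψ : orderOf ψ = 4)
    (χ : MulChar F K) :
    χ 256 * (gaussSum χ e * gaussSum (χ * ψ) e * gaussSum (χ * ψ ^ 2) e * gaussSum (χ * ψ ^ 3) e) =
      ψ (-1) * Fintype.card F * gaussSum (χ ^ 4) e * gaussSum (ψ ^ 2) e := by
  have h2 := orderOf_sq_of_orderOf_eq_four hψ
  -- Duplication at `χ` and at χψ pairs the four Gauss sums into g(χ²) and g(χ²φ); duplication at χ²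
  -- merges these.
  have d1 := gaussSum_duplication he h2 χ
  have d2 := gaussSum_duplication he h2 (χ * ψ)
  have d3 := gaussSum_duplication he h2 (χ ^ 2)
  have s := gaussSum_sq_of_orderOf_eq_four he hψ
  rw [show χ * ψ * ψ ^ 2 = χ * ψ ^ 3 by rw [mul_assoc, ← pow_succ'], mul_pow,
    MulChar.mul_apply, MulChar.apply_four_of_orderOf_eq_four hψ] at d2
  rw [← pow_mul, MulChar.pow_apply' _ two_ne_zero] at d3
  have h256 : χ 256 = χ 4 ^ 4 := by rw [← map_pow]; norm_num
  rw [h256]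
  have e1 := ψ.apply_neg_one_mul_self
  norm_num at d3
  set x := χ 4
  set y := ψ (-1)
  set g := gaussSum (ψ ^ 2) e
  generalize (Fintype.card F : K) = q at s ⊢
  set g0 := gaussSum χ e
  set g1 := gaussSum (χ * ψ) e
  set g2 := gaussSum (χ * ψ ^ 2) e
  set g3 := gaussSum (χ * ψ ^ 3) e
  set G0 := gaussSum (χ ^ 2) e
  set G1 := gaussSum (χ ^ 2 * ψ ^ 2) e
  linear_combination (-x ^ 4 * g0 * g1 * g2 * g3) * e1 + y * x ^ 2 * (x * y * g1 * g3) * d1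
    + y * x ^ 2 * G0 * g * d2 + y * g ^ 2 * d3 + y * g * gaussSum (χ ^ 4) e * s

end Quartic

/-! ### Twisted torus sums in terms of Gauss sums. -/

section Torus

theorem sum_comm_four {α β M : Type*} [Fintype α] [Fintype β] [AddCommMonoid M]
    (f : α → α → α → α → β → M) :
    ∑ a, ∑ b, ∑ c, ∑ d, ∑ x, f a b c d x = ∑ x, ∑ a, ∑ b, ∑ c, ∑ d, f a b c d x := by
  symm
  rw [sum_comm]
  refine sum_congr rfl fun a _ => ?_
  rw [sum_comm]
  refine sum_congr rfl fun b _ => ?_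
  rw [sum_comm]
  refine sum_congr rfl fun c _ => ?_
  rw [sum_comm]

theorem sum_mul_four {α : Type*} [Fintype α] (f₁ f₂ f₃ f₄ : α → K) :
    ∑ a, ∑ b, ∑ c, ∑ d, f₁ a * f₂ b * f₃ c * f₄ d =
      (∑ a, f₁ a) * (∑ a, f₂ a) * (∑ a, f₃ a) * ∑ a, f₄ a := by
  simp only [← mul_sum, ← sum_mul]

/-- A character sum over the solutions of `a b c d = 1`, `a + b + c + d = s`. -/
def torusSum (s : F) (A B C D : MulChar F K) : K :=
  ∑ a : Fˣ, ∑ b : Fˣ, ∑ c : Fˣ, ∑ d : Fˣ,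
    if a * b * c * d = 1 ∧ (a + b + c + d : F) = s then A a * B b * C c * D d else 0

variable {e : AddChar F K} [IsAlgClosed K] [CharZero K]

theorem sum_mulChar_units [DecidableEq (MulChar F K)] (χ : MulChar F K) :
    ∑ u : Fˣ, χ u = if χ = 1 then (Fintype.card F : K) - 1 else 0 := by
  have h2 := MulChar.sum_units_eq χ (fun _ => (1 : K))
  simp only [mul_one] at h2
  rw [← h2]
  split_ifs with h
  · rw [h, MulChar.sum_one_eq_card_units, cast_card_units]
  · rw [MulChar.sum_eq_zero_of_ne_one h]

/-- A sum over `χ` detects abcd = 1 and a sum over additive shifts θ detects a + b + c + d = s,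
after which the four variables separate. The shift θ = 0 gives the degenerate term. -/
theorem torusSum_eq_gaussSum [Fintype (MulChar F K)] [DecidableEq (MulChar F K)]
    (he : e.IsPrimitive) {A B C D : MulChar F K} (h : A * B * C * D = 1) (s : Fˣ) :
    (Fintype.card F : K) * (Fintype.card F - 1) * torusSum (s : F) A B C D =
      ∑ χ : MulChar F K, ((if χ * A = 1 ∧ χ * B = 1 ∧ χ * C = 1 ∧ χ * D = 1
          then ((Fintype.card F : K) - 1) ^ 4 else 0) +
        χ (s ^ 4) * (gaussSum (χ * A) e * gaussSum (χ * B) e * gaussSum (χ * C) e *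
          gaussSum (χ * D) e * gaussSum (χ ^ 4)⁻¹ e)) := by
  have h1 : (Fintype.card F : K) * (Fintype.card F - 1) * torusSum (s : F) A B C D =
      ∑ χ : MulChar F K, ∑ θ : F, e (-(θ * s)) *
        ((∑ a : Fˣ, (χ * A) a * e (θ * a)) * (∑ a : Fˣ, (χ * B) a * e (θ * a)) *
          (∑ a : Fˣ, (χ * C) a * e (θ * a)) * ∑ a : Fˣ, (χ * D) a * e (θ * a)) := by
    simp only [← sum_mul_four]
    simp only [mul_sum]
    simp only [← sum_comm_four]
    simp only [torusSum, mul_sum]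
    refine sum_congr rfl fun a _ => sum_congr rfl fun b _ => sum_congr rfl fun c _ =>
      sum_congr rfl fun d _ => ?_
    have o1 := MulChar.sum_apply_units (K := K) (a * b * c * d)
    have o2 := AddChar.sum_mulShift ((a + b + c + d : F) - s) he
    have : ∀ χ : MulChar F K, ∀ θ : F, e (-(θ * s)) * ((χ * A) a * e (θ * a) *
        ((χ * B) b * e (θ * b)) * ((χ * C) c * e (θ * c)) * ((χ * D) d * e (θ * d))) =
        (A a * B b * C c * D d) * (χ (a * b * c * d : Fˣ) * e (θ * ((a + b + c + d : F) - s))) := by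
      intro χ θ
      rw [show θ * ((a + b + c + d : F) - s) = -(θ * s) + θ * a + θ * b + θ * c + θ * d by ring]
      simp only [AddChar.map_add_eq_mul, MulChar.mul_apply, Units.val_mul, map_mul]
      ring
    simp only [this]
    simp only [← mul_sum, ← sum_mul]
    rw [o1, o2]
    simp only [sub_eq_zero]
    by_cases p : a * b * c * d = 1 <;> by_cases p' : (a + b + c + d : F) = s <;> simp [p, p']
    ring
  rw [h1]
  refine sum_congr rfl fun χ _ => ?_
  rw [sum_eq_zero_add_sum_units]
  congr 1
  · simp only [zero_mul, neg_zero, AddChar.map_zero_eq_one, mul_one, one_mul, sum_mulChar_units]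
    by_cases p1 : χ * A = 1 <;> by_cases p2 : χ * B = 1 <;> by_cases p3 : χ * C = 1 <;>
      by_cases p4 : χ * D = 1 <;> simp [p1, p2, p3, p4]
    ring
  · simp only [sum_units_mul_addChar_mul]
    -- As ABCD = 1, the four inner sums together contribute χ⁻⁴(θ), so θ ≠ 0 yields a fifth Gauss
    -- sum shifted by -s; the fourth power absorbs the sign.
    have h2 : χ (s ^ 4) * gaussSum (χ ^ 4)⁻¹ e = ∑ θ : Fˣ, (χ ^ 4)⁻¹ θ * e ((-s : Fˣ) * θ) := by
      rw [sum_units_mul_addChar_mul, inv_inv, MulChar.pow_apply_coe, ← map_pow]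
      congr 2
      push_cast
      ring
    have h3 : χ * A * (χ * B) * (χ * C) * (χ * D) = χ ^ 4 := by
      rw [show χ * A * (χ * B) * (χ * C) * (χ * D) = χ ^ 4 * (A * B * C * D) by
        simp only [pow_succ, pow_zero, one_mul]; ac_rfl, h, mul_one]
    calc _ = (∑ θ : Fˣ, (χ ^ 4)⁻¹ θ * e ((-s : Fˣ) * θ)) * (gaussSum (χ * A) e *
          gaussSum (χ * B) e * gaussSum (χ * C) e * gaussSum (χ * D) e) := by
          rw [sum_mul]
          refine sum_congr rfl fun θ _ => ?_
          rw [← h3]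
          simp only [mul_inv, MulChar.mul_apply]
          rw [show ((-s : Fˣ) : F) * θ = -(θ * s) by push_cast; ring]
          ring
      _ = _ := by rw [← h2]; ring

end Torus

/-! ### The untwisted class and the ₃F₂. -/

section Evaluation

theorem four_ne_zero_of_orderOf_eq_four [IsAlgClosed K] [CharZero K] {ψ : MulChar F K}
    (hψ : orderOf ψ = 4) : (4 : F) ≠ 0 := by
  have := two_ne_zero_of_orderOf_eq_two (orderOf_sq_of_orderOf_eq_four hψ)
  rw [show (4 : F) = 2 * 2 by norm_num]
  exact mul_ne_zero this this

theorem MulChar.inv_apply_mul_apply (χ : MulChar F K) {a : F} (ha : a ≠ 0) : χ⁻¹ a * χ a = 1 := by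
  rw [MulChar.inv_apply_eq_inv']
  exact inv_mul_cancel₀ (MulChar.apply_ne_zero_iff.mpr ha.isUnit)

variable {e : AddChar F K} [IsAlgClosed K] [CharZero K]

theorem gaussSum_quadruplication_inv (he : e.IsPrimitive) {ψ : MulChar F K} (hψ : orderOf ψ = 4)
    (χ : MulChar F K) :
    χ 256 * gaussSum (χ ^ 4)⁻¹ e * (ψ (-1) * Fintype.card F * gaussSum (ψ ^ 2) e) =
      gaussSum χ⁻¹ e * gaussSum (χ⁻¹ * ψ) e * gaussSum (χ⁻¹ * ψ ^ 2) e *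
        gaussSum (χ⁻¹ * ψ ^ 3) e := by
  have h := gaussSum_quadruplication he hψ χ⁻¹
  have h4 : (256 : F) ≠ 0 := by
    rw [show (256 : F) = 4 ^ 4 by norm_num]
    exact pow_ne_zero _ (four_ne_zero_of_orderOf_eq_four hψ)
  have h1 := χ.inv_apply_mul_apply h4
  rw [inv_pow] at h
  linear_combination -χ 256 * h + gaussSum χ⁻¹ e * gaussSum (χ⁻¹ * ψ) e *
    gaussSum (χ⁻¹ * ψ ^ 2) e * gaussSum (χ⁻¹ * ψ ^ 3) e * h1

theorem sum_mulChar_mul_ite [Fintype (MulChar F K)] [DecidableEq (MulChar F K)]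
    (A : MulChar F K) (f : MulChar F K → K) (c : K) :
    ∑ χ, f χ * (if χ * A = 1 then c else 0) = f A⁻¹ * c := by
  simp [mul_eq_one_iff_eq_inv]

theorem MulChar.apply_four_mul_pow_four (χ : MulChar F K) (u : Fˣ) :
    χ ((4 * u : F) ^ 4) = χ 256 * χ (u ^ 4 : Fˣ) := by
  rw [← map_mul]
  congr 1
  push_cast
  ring

/-- The factor χ(256) of Hasse–Davenport is absorbed by χ((4u)⁴), which is why 4λ is the natural
parameter. After splitting g(χ⁻⁴), one factor g(χ)g(χ⁻¹) is replaced by χ(-1)q, with an error at χ =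
1 only. -/
theorem torusSum_one_eq_gaussSum [Fintype (MulChar F K)] (he : e.IsPrimitive)
    {ψ : MulChar F K} (hψ : orderOf ψ = 4) (u : Fˣ) :
    ψ (-1) * Fintype.card F * gaussSum (ψ ^ 2) e *
        ((Fintype.card F : K) * (Fintype.card F - 1) * torusSum (4 * u : F) (1 : MulChar F K) 1 1 1) =
      ψ (-1) * Fintype.card F * gaussSum (ψ ^ 2) e *
        (((Fintype.card F : K) - 1) ^ 4 + ((Fintype.card F : K) - 1)) +
      Fintype.card F * ∑ χ : MulChar F K, χ (u ^ 4 : Fˣ) * (χ (-1) * (gaussSum χ e ^ 3 *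
        (gaussSum (χ⁻¹ * ψ) e * gaussSum (χ⁻¹ * ψ ^ 2) e * gaussSum (χ⁻¹ * ψ ^ 3) e))) := by
  classical
  have h := torusSum_eq_gaussSum he (show (1 : MulChar F K) * 1 * 1 * 1 = 1 by simp)
    (Units.mk0 4 (four_ne_zero_of_orderOf_eq_four hψ) * u)
  push_cast at h
  simp only [Units.val_mk0] at h
  rw [h, sum_add_distrib, mul_add, mul_add, add_assoc]
  congr 1
  · simp
  · have key : ∀ χ : MulChar F K, ψ (-1) * Fintype.card F * gaussSum (ψ ^ 2) e *
        (χ ((4 * u : F) ^ 4) * (gaussSum (χ * 1) e * gaussSum (χ * 1) e * gaussSum (χ * 1) e *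
          gaussSum (χ * 1) e * gaussSum (χ ^ 4)⁻¹ e)) =
        Fintype.card F * (χ (u ^ 4 : Fˣ) * (χ (-1) * (gaussSum χ e ^ 3 *
        (gaussSum (χ⁻¹ * ψ) e * gaussSum (χ⁻¹ * ψ ^ 2) e * gaussSum (χ⁻¹ * ψ ^ 3) e)))) -
        (χ (u ^ 4 : Fˣ) * (χ (-1) * (gaussSum χ e ^ 3 *
        (gaussSum (χ⁻¹ * ψ) e * gaussSum (χ⁻¹ * ψ ^ 2) e * gaussSum (χ⁻¹ * ψ ^ 3) e)))) *
        if χ * 1 = 1 then (Fintype.card F : K) - 1 else 0 := by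
      intro χ
      rw [χ.apply_four_mul_pow_four]
      have h1 := gaussSum_quadruplication_inv he hψ χ
      have h2 := gaussSum_mul_gaussSum_inv he χ
      simp only [mul_one]
      generalize (if χ = 1 then (Fintype.card F : K) - 1 else 0) = δ at *
      linear_combination χ (u ^ 4 : Fˣ) * gaussSum χ e ^ 4 * h1 +
        χ (u ^ 4 : Fˣ) * gaussSum χ e ^ 3 * (gaussSum (χ⁻¹ * ψ) e * gaussSum (χ⁻¹ * ψ ^ 2) e *
          gaussSum (χ⁻¹ * ψ ^ 3) e) * h2
    rw [mul_sum, sum_congr rfl fun χ _ => key χ, sum_sub_distrib, sum_mulChar_mul_ite, mul_sum]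
    simp only [inv_one, one_mul, MulChar.one_apply_coe, gaussSum_one_of_isPrimitive he,
      MulChar.one_apply (show IsUnit (-1 : F) by simp)]
    have := gaussSum_mul_gaussSum_cube he hψ
    linear_combination ((Fintype.card F : K) - 1) * gaussSum (ψ ^ 2) e * this

theorem greeneHyp_eq_sum [Fintype (MulChar F K)] {n : ℕ}
    (A : Fin (n + 1) → MulChar F K) (B : Fin n → MulChar F K) (x : F) :
    greeneHyp A B x = (Fintype.card F : K) / ((Fintype.card F : K) - 1) *
      ∑ χ : MulChar F K, greeneBinom (A 0 * χ) χ *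
        (∏ i : Fin n, greeneBinom (A i.succ * χ) (B i * χ)) * χ x := by
  rw [greeneHyp]
  congr!

/-- Each binomial is a product of three Gauss sums. Those not involving `χ` multiply to
g(ψ)g(φ)g(ψ³), and `χ` is replaced by its inverse to move the argument 1/u⁴ to u⁴. -/
theorem greeneHyp_three_two_eq_gaussSum [Fintype (MulChar F K)] (he : e.IsPrimitive)
    {ψ : MulChar F K} (hψ : orderOf ψ = 4) (u : Fˣ) :
    (Fintype.card F : K) ^ 3 * (Fintype.card F - 1) * ((Fintype.card F : K) ^ 2 *
        greeneHyp ![ψ, ψ ^ 2, ψ ^ 3] ![1, 1] (1 / (u : F) ^ 4)) =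
      ψ (-1) * Fintype.card F * gaussSum (ψ ^ 2) e *
       ∑ χ : MulChar F K, χ (u ^ 4 : Fˣ) * (χ (-1) * (gaussSum χ e ^ 3 *
        (gaussSum (χ⁻¹ * ψ) e * gaussSum (χ⁻¹ * ψ ^ 2) e * gaussSum (χ⁻¹ * ψ ^ 3) e))) := by
  have hq := cast_card_ne_zero (F := F) (K := K)
  have hq1 := cast_card_sub_one_ne_zero (F := F) (K := K)
  have key : ∀ χ : MulChar F K, (Fintype.card F : K) ^ 6 *
      (greeneBinom (ψ * χ⁻¹) χ⁻¹ * (greeneBinom (ψ ^ 2 * χ⁻¹) χ⁻¹ * greeneBinom (ψ ^ 3 * χ⁻¹) χ⁻¹) *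
        χ⁻¹ (1 / (u : F) ^ 4)) =
      ψ (-1) * Fintype.card F * gaussSum (ψ ^ 2) e * (χ (u ^ 4 : Fˣ) * (χ (-1) * (gaussSum χ e ^ 3 *
        (gaussSum (χ⁻¹ * ψ) e * gaussSum (χ⁻¹ * ψ ^ 2) e * gaussSum (χ⁻¹ * ψ ^ 3) e)))) := by
    intro χ
    -- The range 0 < j < 4 keeps `ψ ^ j` nontrivial, so the excluded pair of trivial characters
    -- never occurs.
    have b : ∀ j, j ∈ Set.Ioo 0 4 → greeneBinom (ψ ^ j * χ⁻¹) χ⁻¹ =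
        (ψ ^ j) (-1) * χ (-1) / (Fintype.card F : K) ^ 2 *
        (gaussSum (χ⁻¹ * ψ ^ j) e * gaussSum χ e * gaussSum (ψ ^ (4 - j)) e) := by
      intro j hj
      rw [greeneBinom_eq_gaussSum he, MulChar.mul_apply, MulChar.inv_apply_neg_one, inv_inv,
        mul_inv, inv_inv, mul_assoc (ψ ^ j)⁻¹, mul_inv_cancel, mul_one, mul_comm χ⁻¹,
        inv_eq_of_mul_eq_one_right (a := ψ ^ j) (b := ψ ^ (4 - j))]
      · rw [← pow_add, Nat.add_sub_cancel' hj.2.le, pow_four_of_orderOf_eq_four hψ]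
      · rintro ⟨h1, h2⟩
        rw [h2, mul_one] at h1
        have := orderOf_dvd_of_pow_eq_one h1
        rw [hψ] at this
        exact absurd (Nat.le_of_dvd hj.1 this) (by simpa using hj.2)
    have b1 := b 1 (by simp)
    have b2 := b 2 (by simp)
    have b3 := b 3 (by simp)
    have b0 : χ⁻¹ (1 / (u : F) ^ 4) = χ (u ^ 4 : Fˣ) := by
      rw [MulChar.inv_apply']; simp
    simp only [pow_one, Nat.reduceSub] at b1 b2 b3
    rw [b0, b1, b2, b3, sq_apply_neg_one, MulChar.pow_apply' _ (by norm_num)]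
    have c1 := gaussSum_mul_gaussSum_cube he hψ
    have c2 := ψ.apply_neg_one_mul_self
    have c3 := χ.apply_neg_one_mul_self
    have c6 : ψ (-1) ^ 4 = 1 := by linear_combination (ψ (-1) ^ 2 + 1) * c2
    field_simp
    simp only [c6]
    linear_combination (gaussSum (χ⁻¹ * ψ) e * gaussSum χ e ^ 3 * gaussSum (χ⁻¹ * ψ ^ 2) e *
      gaussSum (ψ ^ 2) e * gaussSum (χ⁻¹ * ψ ^ 3) e * χ (u ^ 4 : Fˣ) * χ (-1)) *
      (gaussSum ψ e * gaussSum (ψ ^ 3) e * c3 + c1)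
  have hsum := sum_congr (M := K) (rfl : (univ : Finset (MulChar F K)) = univ) fun χ _ => key χ
  rw [← mul_sum, ← mul_sum] at hsum
  rw [greeneHyp_eq_sum, ← hsum, ← Equiv.sum_comp (Equiv.inv (MulChar F K))]
  simp only [Matrix.cons_val_zero, Fin.prod_univ_two, Matrix.cons_val_succ, one_mul,
    Matrix.cons_val_one, Equiv.inv_apply]
  field_simp

theorem torusSum_one_eq_greeneHyp {ψ : MulChar F K} (he : e.IsPrimitive) (hψ : orderOf ψ = 4)
    (u : Fˣ) :
    (Fintype.card F : K) * torusSum (4 * u : F) (1 : MulChar F K) 1 1 1 =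
      ((Fintype.card F : K) - 1) ^ 3 + 1 + Fintype.card F * ((Fintype.card F : K) ^ 2 *
        greeneHyp ![ψ, ψ ^ 2, ψ ^ 3] ![1, 1] (1 / (u : F) ^ 4)) := by
  have := Fintype.ofFinite (MulChar F K)
  have hq := cast_card_ne_zero (F := F) (K := K)
  have hq1 := cast_card_sub_one_ne_zero (F := F) (K := K)
  have h1 := torusSum_one_eq_gaussSum he hψ u
  have h2 := greeneHyp_three_two_eq_gaussSum he hψ u
  have h3 := gaussSum_sq_of_orderOf_eq_four he hψ
  have h4 := ψ.apply_neg_one_mul_self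
  apply mul_left_cancel₀ hq1
  apply mul_left_cancel₀ (pow_ne_zero 3 hq)
  generalize (∑ χ : MulChar F K, χ (u ^ 4 : Fˣ) * (χ (-1) * (gaussSum χ e ^ 3 *
    (gaussSum (χ⁻¹ * ψ) e * gaussSum (χ⁻¹ * ψ ^ 2) e * gaussSum (χ⁻¹ * ψ ^ 3) e)))) = U at *
  generalize greeneHyp ![ψ, ψ ^ 2, ψ ^ 3] ![1, 1] (1 / (u : F) ^ 4) = H at *
  generalize torusSum (4 * u : F) (1 : MulChar F K) 1 1 1 = S at *
  generalize ψ (-1) = y at *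
  generalize gaussSum (ψ ^ 2) e = g at *
  generalize (Fintype.card F : K) = q at *
  have h5 : (y * q * g) ^ 2 = q ^ 3 := by linear_combination y ^ 2 * q ^ 2 * h3 + q ^ 3 * h4
  linear_combination (y * q * g) * h1 - q * h2 - (q * (q - 1) * S - (q - 1) ^ 4 - (q - 1)) * h5

end Evaluation

/-! ### The class (1,1,φ,φ) and the ₂F₁. -/

section EvaluationTwisted

variable {e : AddChar F K} [IsAlgClosed K] [CharZero K]

theorem sum_mulChar_mul_ite_sq [Fintype (MulChar F K)] [DecidableEq (MulChar F K)]
    {φ : MulChar F K} (hφ : orderOf φ = 2) (f : MulChar F K → K) (c : K) :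
    ∑ χ, f χ * (if χ ^ 2 = 1 then c else 0) = (f 1 + f φ) * c := by
  simp only [mul_ite, mul_zero, ← sum_filter, MulChar.filter_pow_eq_one (by norm_num) hφ,
    range_add_one, range_zero, image_insert, pow_one, pow_zero, insert_empty_eq, image_singleton]
  rw [sum_pair, add_mul, add_comm]
  rintro rfl
  simp at hφ

/-- Two copies of g(χ)g(χφ) collapse to g(χ²)² and g(χ⁻⁴) splits into g(χ⁻²)g(χ⁻²φ); reflection then
removes one g(χ²)g(χ⁻²). The final summand is the correction from χ² = 1, that is from 1 and `φ`. -/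
theorem torusSum_sq_eq_gaussSum [Fintype (MulChar F K)] (he : e.IsPrimitive)
    {ψ : MulChar F K} (hψ : orderOf ψ = 4) (u : Fˣ) :
    gaussSum (ψ ^ 2) e * ((Fintype.card F - 1) *
        torusSum (4 * u : F) (1 : MulChar F K) 1 (ψ ^ 2) (ψ ^ 2)) =
      Fintype.card F * ∑ χ : MulChar F K, χ (u ^ 4 : Fˣ) *
        (gaussSum (χ ^ 2) e * gaussSum ((χ ^ 2)⁻¹ * ψ ^ 2) e) +
      2 * (Fintype.card F - 1) * gaussSum (ψ ^ 2) e := by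
  classical
  have hq := cast_card_ne_zero (F := F) (K := K)
  have hψ4 := pow_four_of_orderOf_eq_four hψ
  have hφ := orderOf_sq_of_orderOf_eq_four hψ
  have hφ1 : ψ ^ 2 ≠ 1 := by intro h; rw [h] at hφ; simp at hφ
  have h := torusSum_eq_gaussSum he
    (show (1 : MulChar F K) * 1 * ψ ^ 2 * ψ ^ 2 = 1 by simpa [← pow_add] using hψ4)
    (Units.mk0 4 (four_ne_zero_of_orderOf_eq_four hψ) * u)
  push_cast at h
  simp only [Units.val_mk0] at h
  apply mul_left_cancel₀ hq
  have key : ∀ χ : MulChar F K, gaussSum (ψ ^ 2) e *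
      ((if χ * 1 = 1 ∧ χ * 1 = 1 ∧ χ * ψ ^ 2 = 1 ∧ χ * ψ ^ 2 = 1
          then ((Fintype.card F : K) - 1) ^ 4 else 0) + χ ((4 * u : F) ^ 4) *
        (gaussSum (χ * 1) e * gaussSum (χ * 1) e * gaussSum (χ * ψ ^ 2) e *
          gaussSum (χ * ψ ^ 2) e * gaussSum (χ ^ 4)⁻¹ e)) =
      Fintype.card F * (Fintype.card F * (χ (u ^ 4 : Fˣ) *
        (gaussSum (χ ^ 2) e * gaussSum ((χ ^ 2)⁻¹ * ψ ^ 2) e))) -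
      (Fintype.card F * (χ (u ^ 4 : Fˣ) *
        (gaussSum (χ ^ 2) e * gaussSum ((χ ^ 2)⁻¹ * ψ ^ 2) e))) *
        if χ ^ 2 = 1 then (Fintype.card F : K) - 1 else 0 := by
    intro χ
    rw [χ.apply_four_mul_pow_four, if_neg]
    · have d1 := gaussSum_duplication he hφ χ
      have d2 := gaussSum_duplication he hφ (χ ^ 2)⁻¹
      have s := gaussSum_sq_of_orderOf_eq_four he hψ
      have p := gaussSum_mul_gaussSum_inv he (χ ^ 2)
      have i1 := (χ ^ 2).inv_apply_mul_apply (four_ne_zero_of_orderOf_eq_four hψ)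
      rw [sq_apply_neg_one] at p
      rw [inv_pow, ← pow_mul] at d2
      rw [MulChar.pow_apply' χ two_ne_zero] at i1
      have h256 : χ 256 = χ 4 ^ 4 := by rw [← map_pow]; norm_num
      rw [h256]
      simp only [mul_one]
      generalize (if χ ^ 2 = 1 then (Fintype.card F : K) - 1 else 0) = δ at *
      norm_num at d2
      generalize gaussSum (ψ ^ 2) e = g at *
      generalize gaussSum (χ ^ 4)⁻¹ e = G4 at *
      generalize gaussSum ((χ ^ 2)⁻¹ * ψ ^ 2) e = G3 at *
      generalize gaussSum (χ ^ 2)⁻¹ e = G2 at *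
      generalize gaussSum (χ ^ 2) e = G1 at *
      generalize gaussSum (χ * ψ ^ 2) e = g1 at *
      generalize gaussSum χ e = g0 at *
      generalize (χ ^ 2)⁻¹ 4 = z at *
      generalize χ 4 = x at *
      generalize (Fintype.card F : K) = q at *
      generalize χ (u ^ 4 : Fˣ) = v at *
      have d1' : x ^ 2 * (g0 * g1) ^ 2 = G1 ^ 2 * q := by
        linear_combination (x * (g0 * g1) + G1 * g) * d1 + G1 ^ 2 * s
      linear_combination -v * x ^ 4 * g0 ^ 2 * g1 ^ 2 * d2 + v * x ^ 2 * g0 ^ 2 * g1 ^ 2 * G2 * G3 * i1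
        + v * G2 * G3 * d1' + v * q * G1 * G3 * p
    · rintro ⟨h1, -, h2, -⟩
      rw [mul_one] at h1
      rw [h1, one_mul] at h2
      exact hφ1 h2
  have hs : gaussSum (ψ ^ 2) e * ((Fintype.card F : K) * (Fintype.card F - 1) *
      torusSum (4 * u : F) (1 : MulChar F K) 1 (ψ ^ 2) (ψ ^ 2)) =
      Fintype.card F * (Fintype.card F * ∑ χ : MulChar F K, χ (u ^ 4 : Fˣ) *
        (gaussSum (χ ^ 2) e * gaussSum ((χ ^ 2)⁻¹ * ψ ^ 2) e)) +
      2 * Fintype.card F * (Fintype.card F - 1) * gaussSum (ψ ^ 2) e := by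
    rw [h, mul_sum, sum_congr rfl fun χ _ => key χ, sum_sub_distrib, sum_mulChar_mul_ite_sq hφ,
      ← mul_sum, ← mul_sum]
    have hu : (ψ ^ 2) (u ^ 4 : Fˣ) = 1 := by
      rw [Units.val_pow_eq_pow_val, MulChar.apply_pow_units, ← pow_mul,
        show 2 * 4 = 4 * 2 from rfl, pow_mul, hψ4, one_pow, MulChar.one_apply_coe]
    rw [hu, ← pow_mul, hψ4]
    simp only [one_pow, inv_one, one_mul, MulChar.one_apply_coe, gaussSum_one_of_isPrimitive he]
    ring
  linear_combination hs

/-- Duplication merges g(χψ)g(χψ³) and g(χ⁻¹)g(χ⁻¹φ). The binomial in front supplies g(ψ³)², which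
meets g(ψ)² from the series to give q². -/
theorem greeneBinom_mul_greeneHyp_two_one [Fintype (MulChar F K)] (he : e.IsPrimitive)
    {ψ : MulChar F K} (hψ : orderOf ψ = 4) (u : Fˣ) :
    ((Fintype.card F : K) - 1) * ((Fintype.card F : K) ^ 2 * greeneBinom (ψ ^ 3) ψ *
        greeneHyp ![ψ ^ 3, ψ] ![ψ ^ 2] (1 / (u : F) ^ 4)) =
      gaussSum (ψ ^ 2) e * ∑ χ : MulChar F K, χ (u ^ 4 : Fˣ) *
        (gaussSum (χ ^ 2) e * gaussSum ((χ ^ 2)⁻¹ * ψ ^ 2) e) := by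
  have hq := cast_card_ne_zero (F := F) (K := K)
  have hq1 := cast_card_sub_one_ne_zero (F := F) (K := K)
  have hψ4 := pow_four_of_orderOf_eq_four hψ
  have hφ := orderOf_sq_of_orderOf_eq_four hψ
  have hψ1 := ne_one_of_orderOf_eq_four hψ
  have hi : ψ⁻¹ = ψ ^ 3 := inv_eq_of_mul_eq_one_right (by rw [← pow_succ', hψ4])
  have h3 : ψ ^ 3 ≠ 1 := by rw [← hi]; simpa using hψ1
  have hi3 : (ψ ^ 3)⁻¹ = ψ := by rw [← hi, inv_inv]
  have y2 := ψ.apply_neg_one_mul_self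
  have hy3 : (ψ ^ 3) (-1) = ψ (-1) := by rw [← hi, MulChar.inv_apply_neg_one]
  have b0 : greeneBinom (ψ ^ 3) ψ = ψ (-1) / (Fintype.card F : K) ^ 2 *
      (gaussSum (ψ ^ 3) e * gaussSum (ψ ^ 3) e * gaussSum (ψ ^ 2) e) := by
    rw [greeneBinom_eq_gaussSum he fun h => hψ1 h.2, hi3, hi, hy3, ← pow_two ψ]
  have key : ∀ χ : MulChar F K, (Fintype.card F : K) ^ 3 * greeneBinom (ψ ^ 3) ψ *
      (greeneBinom (ψ ^ 3 * χ) χ * greeneBinom (ψ * χ) (ψ ^ 2 * χ) * χ (1 / (u : F) ^ 4)) =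
      gaussSum (ψ ^ 2) e * (χ⁻¹ (u ^ 4 : Fˣ) *
        (gaussSum (χ⁻¹ ^ 2) e * gaussSum ((χ⁻¹ ^ 2)⁻¹ * ψ ^ 2) e)) := by
    intro χ
    have b1 : greeneBinom (ψ ^ 3 * χ) χ = ψ (-1) * χ (-1) / (Fintype.card F : K) ^ 2 *
        (gaussSum (χ * ψ ^ 3) e * gaussSum χ⁻¹ e * gaussSum ψ e) := by
      rw [greeneBinom_eq_gaussSum he, MulChar.mul_apply, hy3, mul_inv, inv_mul_cancel_right, hi3,
        mul_comm χ, mul_assoc (gaussSum _ e)]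
      rintro ⟨h1, h2⟩
      rw [h2, mul_one] at h1
      exact h3 h1
    have b2 : greeneBinom (ψ * χ) (ψ ^ 2 * χ) = ψ (-1) * χ (-1) / (Fintype.card F : K) ^ 2 *
        (gaussSum (χ * ψ) e * gaussSum (χ⁻¹ * ψ ^ 2) e * gaussSum ψ e) := by
      rw [greeneBinom_eq_gaussSum he, MulChar.mul_apply]
      · rw [show (ψ ^ 2 * χ)⁻¹ = χ⁻¹ * ψ ^ 2 by
            rw [mul_inv_rev, inv_eq_of_mul_eq_one_right (a := ψ ^ 2) (b := ψ ^ 2)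
              (by rw [← pow_add, hψ4])],
          show (ψ * χ)⁻¹ * (ψ ^ 2 * χ) = ψ by
            rw [pow_two, mul_assoc ψ ψ χ, mul_left_comm, inv_mul_cancel, mul_one], mul_comm χ]
      · rintro ⟨h1, h2⟩
        have : ψ ^ 2 * χ = ψ * χ := by rw [h1, h2]
        rw [mul_left_inj, pow_two, mul_eq_left] at this
        exact hψ1 this
    have hx : χ (1 / (u : F) ^ 4) = χ⁻¹ (u ^ 4 : Fˣ) := by
      rw [MulChar.inv_apply']; simp
    have d1 := gaussSum_duplication he hφ (χ * ψ)
    have d2 := gaussSum_duplication he hφ χ⁻¹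
    rw [mul_assoc, ← pow_succ', mul_pow, MulChar.mul_apply,
      MulChar.apply_four_of_orderOf_eq_four hψ] at d1
    have s := gaussSum_sq_of_orderOf_eq_four he hψ
    have c := gaussSum_mul_gaussSum_cube he hψ
    have c3 := χ.apply_neg_one_mul_self
    have i1 := χ.inv_apply_mul_apply (four_ne_zero_of_orderOf_eq_four hψ)
    rw [hx, b0, b1, b2, inv_pow, inv_inv]
    rw [inv_pow] at d2
    norm_num at d1
    field_simp
    generalize gaussSum (ψ ^ 2) e = g at *
    generalize gaussSum (ψ ^ 3) e = g3 at *
    generalize gaussSum ψ e = g1 at *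
    generalize gaussSum (χ ^ 2)⁻¹ e = G2 at *
    generalize gaussSum (χ ^ 2 * ψ ^ 2) e = G1 at *
    generalize gaussSum (χ * ψ ^ 3) e = a3 at *
    generalize gaussSum (χ * ψ) e = a1 at *
    generalize gaussSum χ⁻¹ e = c0 at *
    generalize gaussSum (χ⁻¹ * ψ ^ 2) e = c2 at *
    generalize χ⁻¹ 4 = z at *
    generalize χ 4 = x at *
    generalize (Fintype.card F : K) = q at *
    generalize χ⁻¹ (u ^ 4 : Fˣ) = v at *
    generalize ψ (-1) = y at *
    generalize χ (-1) = w at *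
    have e1 : y * (a1 * a3 * (c0 * c2)) = G1 * G2 * q := by
      linear_combination y * (-a1 * a3 * c0 * c2) * i1 + z * (c0 * c2) * d1 + G1 * g * d2 + G1 * G2 * s
    have e2 : (g1 * g3) ^ 2 = q ^ 2 := by
      linear_combination (g1 * g3 + y * q) * c + q ^ 2 * y2
    have w2 : w ^ 2 = 1 := by linear_combination c3
    have y3 : y ^ 3 = y := by linear_combination y * y2
    simp only [w2, y3]
    linear_combination v * g * (g1 * g3) ^ 2 * e1 + v * g * G1 * G2 * q * e2
  have hsum := sum_congr (M := K) (rfl : (univ : Finset (MulChar F K)) = univ) fun χ _ => key χ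
  rw [← mul_sum, ← mul_sum] at hsum
  rw [greeneHyp_eq_sum, ← Equiv.sum_comp (Equiv.inv (MulChar F K)) fun χ => χ (u ^ 4 : Fˣ) *
        (gaussSum (χ ^ 2) e * gaussSum ((χ ^ 2)⁻¹ * ψ ^ 2) e)]
  simp only [Matrix.cons_val_zero, Fin.prod_univ_one, Matrix.cons_val_succ,
    Matrix.cons_val_fin_one, Equiv.inv_apply]
  rw [← hsum]
  field_simp

theorem torusSum_sq_eq_greeneHyp {ψ : MulChar F K} (he : e.IsPrimitive) (hψ : orderOf ψ = 4)
    (u : Fˣ) :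
    torusSum (4 * u : F) (1 : MulChar F K) 1 (ψ ^ 2) (ψ ^ 2) =
      (Fintype.card F : K) ^ 2 * greeneBinom (ψ ^ 3) ψ *
        greeneHyp ![ψ ^ 3, ψ] ![ψ ^ 2] (1 / (u : F) ^ 4) + 2 := by
  have := Fintype.ofFinite (MulChar F K)
  have hq1 := cast_card_sub_one_ne_zero (F := F) (K := K)
  have h1 := torusSum_sq_eq_gaussSum he hψ u
  have h2 := greeneBinom_mul_greeneHyp_two_one he hψ u
  have s := gaussSum_sq_of_orderOf_eq_four he hψ
  apply mul_left_cancel₀ hq1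
  apply mul_left_cancel₀ (gaussSum_ne_zero he (ψ ^ 2))
  generalize ∑ χ : MulChar F K, χ (u ^ 4 : Fˣ) *
        (gaussSum (χ ^ 2) e * gaussSum ((χ ^ 2)⁻¹ * ψ ^ 2) e) = W at *
  linear_combination h1 - gaussSum (ψ ^ 2) e * h2 - W * s

end EvaluationTwisted

/-! ### The class (ψ,ψ³,1,1) and closed-form character sums. -/

section EvaluationMixed

variable {e : AddChar F K} [IsAlgClosed K] [CharZero K]

/-- Orthogonality in `χ` after opening both Gauss sums. The case n = 1 serves the mixed class, n = 2
the value of the ₂F₁ at 1. -/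
theorem sum_gaussSum_mul_gaussSum_pow [Fintype (MulChar F K)] (e : AddChar F K)
    (φ : MulChar F K) (n : ℕ) (z : Fˣ) :
    ∑ χ : MulChar F K, χ z * (gaussSum (χ ^ n) e * gaussSum ((χ ^ n)⁻¹ * φ) e) =
      ((Fintype.card F : K) - 1) * ∑ x : Fˣ, ∑ y : Fˣ,
        if z * (x * y⁻¹) ^ n = 1 then φ y * e (x + y) else 0 := by
  simp only [gaussSum_eq_sum_units, sum_mul_sum]
  simp only [mul_sum]
  rw [sum_comm]
  refine sum_congr rfl fun x _ => ?_
  rw [sum_comm]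
  refine sum_congr rfl fun y _ => ?_
  have o := MulChar.sum_apply_units (K := K) (z * (x * y⁻¹) ^ n)
  have h : ∀ χ : MulChar F K, χ z * ((χ ^ n) x * e x * (((χ ^ n)⁻¹ * φ) y * e y)) =
      χ (z * (x * y⁻¹) ^ n : Fˣ) * (φ y * e (x + y)) := by
    intro χ
    rw [AddChar.map_add_eq_mul, MulChar.mul_apply, MulChar.inv_apply', Units.val_mul,
      Units.val_pow_eq_pow_val, map_mul, MulChar.apply_pow_units, Units.val_mul, map_mul,
      Units.val_inv_eq_inv_val]
    ring
  rw [sum_congr rfl fun χ _ => h χ, ← sum_mul, o]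
  split_ifs <;> simp

/-- For nontrivial `χ` both sides vanish at a = 0; allowing this keeps λ⁴ = 1 within the general
formula. -/
theorem sum_units_mul_addChar_mul_of_ne_one (e : AddChar F K) {χ : MulChar F K} (hχ : χ ≠ 1)
    (a : F) : ∑ u : Fˣ, χ u * e (a * u) = χ⁻¹ a * gaussSum χ e := by
  by_cases ha : a = 0
  · classical
    subst ha
    simp [sum_mulChar_units, hχ, MulChar.map_zero]
  · exact sum_units_mul_addChar_mul χ e (Units.mk0 a ha)

theorem sum_gaussSum_mul_gaussSum_inv_mul [Fintype (MulChar F K)] (e : AddChar F K)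
    {φ : MulChar F K} (hφ : φ ≠ 1) (z : Fˣ) :
    ∑ χ : MulChar F K, χ z * (gaussSum χ e * gaussSum (χ⁻¹ * φ) e) =
      ((Fintype.card F : K) - 1) * (φ z * φ⁻¹ (1 + z) * gaussSum φ e) := by
  have h := sum_gaussSum_mul_gaussSum_pow e φ 1 z
  simp only [pow_one] at h
  rw [h, mul_assoc (φ z), ← sum_units_mul_addChar_mul_of_ne_one e hφ]
  congr 1
  rw [mul_sum]
  refine sum_congr rfl fun x _ => ?_
  rw [Fintype.sum_eq_single (z * x)]
  · rw [if_pos (by rw [← mul_assoc, mul_inv_cancel]), Units.val_mul, map_mul, mul_assoc]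
    congr 4
    ring
  · intro y hy
    rw [if_neg]
    intro h
    apply hy
    rw [← mul_assoc, mul_inv_eq_one] at h
    exact h.symm

theorem sum_gaussSum_sq_mul_gaussSum [Fintype (MulChar F K)] (e : AddChar F K)
    {φ : MulChar F K} (hφ : orderOf φ = 2) :
    ∑ χ : MulChar F K, (gaussSum (χ ^ 2) e * gaussSum ((χ ^ 2)⁻¹ * φ) e) =
      ((Fintype.card F : K) - 1) * (φ 2 * gaussSum φ e) := by
  have h2 := two_ne_zero_of_orderOf_eq_two hφ
  have hφ1 : φ ≠ 1 := by rintro rfl; simp at hφ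
  have hi : φ⁻¹ = φ := inv_eq_of_mul_eq_one_right (by rw [← pow_two, ← hφ, pow_orderOf_eq_one])
  have h := sum_gaussSum_mul_gaussSum_pow e φ 2 1
  simp only [Units.val_one, map_one, one_mul] at h
  rw [h]
  congr 1
  have h3 := sum_units_mul_addChar_mul_of_ne_one e hφ1 2
  rw [hi] at h3
  -- The constraint is y = ±x. The branch y = -x has trivial additive factor and sums to zero,
  -- leaving the Gauss sum shifted by 2.
  have h4 : ∑ x : Fˣ, φ (-x : Fˣ) = 0 := by
    classical
    exact (Equiv.sum_comp (Equiv.neg Fˣ) fun x : Fˣ => φ x).trans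
      (by rw [sum_mulChar_units, if_neg hφ1])
  rw [← h3, show ∑ u : Fˣ, φ u * e (2 * u) = ∑ u : Fˣ, φ u * e (2 * u) + ∑ x : Fˣ, φ (-x : Fˣ) by
    rw [h4, add_zero], ← sum_add_distrib]
  refine sum_congr rfl fun x _ => ?_
  have hx : x ≠ -x := by
    intro h
    have h5 : (x : F) = -x := by rw [← Units.val_neg, ← h]
    have h6 : 2 * (x : F) = 0 := by linear_combination h5
    exact mul_ne_zero h2 x.ne_zero h6
  have h5 : ∀ y : Fˣ, (x * y⁻¹) ^ 2 = 1 ↔ y = x ∨ y = -x := by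
    intro y
    rw [mul_pow, inv_pow, mul_inv_eq_one, ← Units.val_inj, ← Units.val_inj, ← Units.val_inj,
      Units.val_pow_eq_pow_val, Units.val_pow_eq_pow_val, Units.val_neg, eq_comm, sq_eq_sq_iff_eq_or_eq_neg]
  simp only [h5]
  have h6 : ∀ y : Fˣ, (if y = x ∨ y = -x then φ y * e (x + y) else 0) =
      (if y = x then φ y * e (x + y) else 0) + if y = -x then φ y * e (x + y) else 0 := by
    intro y
    by_cases p : y = x
    · subst p; simp [hx]
    · simp [p]
  simp only [h6, sum_add_distrib, sum_ite_eq', mem_univ, if_true, Units.val_neg, add_neg_cancel,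
    AddChar.map_zero_eq_one, mul_one, ← two_mul]

/-- After splitting g(χ⁻⁴), three reflection pairs cancel and only g(χ)g(χ⁻¹φ) survives, whose sum
over `χ` is elementary. Reflection fails at χ = 1, ψ³ and ψ, which produces the other terms. -/
theorem torusSum_cube_eq_gaussSum {ψ : MulChar F K} (he : e.IsPrimitive) (hψ : orderOf ψ = 4)
    (u : Fˣ) :
    gaussSum (ψ ^ 2) e * torusSum (4 * u : F) ψ (ψ ^ 3) 1 1 =
      ψ (-1) * (Fintype.card F * (ψ ^ 2) (1 - (u : F) ^ 4) + 1) * gaussSum (ψ ^ 2) e -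
        (gaussSum ψ e ^ 2 + gaussSum (ψ ^ 3) e ^ 2) := by
  classical
  have := Fintype.ofFinite (MulChar F K)
  have hq := cast_card_ne_zero (F := F) (K := K)
  have hq1 := cast_card_sub_one_ne_zero (F := F) (K := K)
  have hψ4 := pow_four_of_orderOf_eq_four hψ
  have hφ := orderOf_sq_of_orderOf_eq_four hψ
  have hψ1 := ne_one_of_orderOf_eq_four hψ
  have hφ1 : ψ ^ 2 ≠ 1 := by intro h; rw [h] at hφ; simp at hφ
  have hi : ψ⁻¹ = ψ ^ 3 := inv_eq_of_mul_eq_one_right (by rw [← pow_succ', hψ4])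
  have hi2 : (ψ ^ 2)⁻¹ = ψ ^ 2 := inv_eq_of_mul_eq_one_right (by rw [← pow_add, hψ4])
  have hi3 : (ψ ^ 3)⁻¹ = ψ := by rw [← hi, inv_inv]
  have y2 := ψ.apply_neg_one_mul_self
  have hy3 : (ψ ^ 3) (-1) = ψ (-1) := by rw [← hi, MulChar.inv_apply_neg_one]
  have h31 : ψ ^ 3 ≠ 1 := by rw [← hi]; simpa using hψ1
  have h := torusSum_eq_gaussSum he
    (show ψ * ψ ^ 3 * 1 * 1 = 1 by rw [mul_one, mul_one, ← pow_succ', hψ4])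
    (Units.mk0 4 (four_ne_zero_of_orderOf_eq_four hψ) * u)
  push_cast at h
  simp only [Units.val_mk0] at h
  let Δ : MulChar F K → K := fun χ =>
    (if χ * 1 = 1 then (Fintype.card F : K) - 1 else 0) +
    (if χ * ψ = 1 then (Fintype.card F : K) - 1 else 0) +
    (if χ * ψ ^ 3 = 1 then (Fintype.card F : K) - 1 else 0)
  let f : MulChar F K → K := fun χ =>
    χ (-u ^ 4 : Fˣ) * (gaussSum χ e * gaussSum (χ⁻¹ * ψ ^ 2) e)
  have key : ∀ χ : MulChar F K, ψ (-1) * Fintype.card F * gaussSum (ψ ^ 2) e *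
      ((if χ * ψ = 1 ∧ χ * ψ ^ 3 = 1 ∧ χ * 1 = 1 ∧ χ * 1 = 1
          then ((Fintype.card F : K) - 1) ^ 4 else 0) + χ ((4 * u : F) ^ 4) *
        (gaussSum (χ * ψ) e * gaussSum (χ * ψ ^ 3) e * gaussSum (χ * 1) e *
          gaussSum (χ * 1) e * gaussSum (χ ^ 4)⁻¹ e)) =
      f χ * ((Fintype.card F : K) ^ 3 - (Fintype.card F : K) ^ 2 * Δ χ) := by
    intro χ
    rw [χ.apply_four_mul_pow_four, if_neg]
    · have p0 := gaussSum_mul_gaussSum_inv he χ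
      have p1 := gaussSum_mul_gaussSum_inv he (χ * ψ)
      have p3 := gaussSum_mul_gaussSum_inv he (χ * ψ ^ 3)
      rw [mul_inv, hi, MulChar.mul_apply] at p1
      rw [mul_inv, hi3, MulChar.mul_apply, hy3] at p3
      have Q := gaussSum_quadruplication_inv he hψ χ
      have w2 := χ.apply_neg_one_mul_self
      have hn : χ (-u ^ 4 : Fˣ) = χ (-1) * χ (u ^ 4 : Fˣ) := by
        rw [← map_mul]; congr 1; push_cast; ring
      simp only [f, Δ, hn, mul_one]
      -- At most one of the three corrections is nonzero, so no cross terms appear.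
      have hδ : ((Fintype.card F : K) - if χ = 1 then (Fintype.card F : K) - 1 else 0) *
          ((Fintype.card F : K) - if χ * ψ = 1 then (Fintype.card F : K) - 1 else 0) *
          ((Fintype.card F : K) - if χ * ψ ^ 3 = 1 then (Fintype.card F : K) - 1 else 0) =
          (Fintype.card F : K) ^ 3 - (Fintype.card F : K) ^ 2 *
          ((if χ = 1 then (Fintype.card F : K) - 1 else 0) +
            (if χ * ψ = 1 then (Fintype.card F : K) - 1 else 0) +
            (if χ * ψ ^ 3 = 1 then (Fintype.card F : K) - 1 else 0)) := by
        by_cases c0 : χ = 1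
        · subst c0
          simp [hψ1, h31]
          ring
        · by_cases c1 : χ * ψ = 1
          · have c3 : χ * ψ ^ 3 ≠ 1 := by
              rw [show χ * ψ ^ 3 = χ * ψ * ψ ^ 2 by rw [mul_assoc, ← pow_succ'], c1, one_mul]
              exact hφ1
            simp [c0, c1, c3]
            ring
          · simp only [c0, c1, if_false]
            ring
      rw [← hδ]
      generalize (if χ = 1 then (Fintype.card F : K) - 1 else 0) = δ0 at *
      generalize (if χ * ψ = 1 then (Fintype.card F : K) - 1 else 0) = δ1 at *
      generalize (if χ * ψ ^ 3 = 1 then (Fintype.card F : K) - 1 else 0) = δ3 at *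
      generalize gaussSum (ψ ^ 2) e = g at *
      generalize gaussSum (χ ^ 4)⁻¹ e = G4 at *
      generalize gaussSum (χ * ψ ^ 3) e = a3 at *
      generalize gaussSum (χ * ψ) e = a1 at *
      generalize gaussSum χ e = a0 at *
      generalize gaussSum χ⁻¹ e = c0 at *
      generalize gaussSum (χ⁻¹ * ψ) e = c1 at *
      generalize gaussSum (χ⁻¹ * ψ ^ 2) e = c2 at *
      generalize gaussSum (χ⁻¹ * ψ ^ 3) e = c3 at *
      generalize χ 256 = x at *
      generalize (Fintype.card F : K) = q at *
      generalize χ (u ^ 4 : Fˣ) = v at *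
      generalize ψ (-1) = y at *
      generalize χ (-1) = w at *
      have t : a0 * c0 * (a1 * c3) * (a3 * c1) = w * ((q - δ0) * (q - δ1) * (q - δ3)) := by
        rw [p0, p1, p3]
        linear_combination w * (q - δ0) * (q - δ1) * (q - δ3) * (y * y * w2 + y2)
      linear_combination v * a1 * a3 * a0 ^ 2 * Q + v * a0 * c2 * t
    · rintro ⟨h1, -, h2, -⟩
      rw [mul_one] at h2
      rw [h2, one_mul] at h1
      exact hψ1 h1
  have hu : ∀ ρ : MulChar F K, ρ ^ 4 = 1 → ρ (-u ^ 4 : Fˣ) = ρ (-1) := by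
    intro ρ hρ
    rw [Units.val_neg, ← neg_one_mul, map_mul, Units.val_pow_eq_pow_val, MulChar.apply_pow_units,
      hρ, MulChar.one_apply_coe, mul_one]
  have V := sum_gaussSum_mul_gaussSum_inv_mul e hφ1 (-u ^ 4)
  have hφu : (ψ ^ 2) (-u ^ 4 : Fˣ) = 1 := by
    rw [hu _ (by rw [← pow_mul, show 2 * 4 = 4 * 2 from rfl, pow_mul, hψ4, one_pow]),
      sq_apply_neg_one]
  have hu1 : (1 : F) + (-u ^ 4 : Fˣ) = 1 - (u : F) ^ 4 := by push_cast; ring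
  rw [hφu, one_mul, hu1, hi2] at V
  have hsum : ψ (-1) * Fintype.card F * gaussSum (ψ ^ 2) e *
      ((Fintype.card F : K) * (Fintype.card F - 1) * torusSum (4 * u : F) ψ (ψ ^ 3) 1 1) =
      (Fintype.card F : K) ^ 3 * ∑ χ, f χ - (Fintype.card F : K) ^ 2 *
        ((f 1 + f (ψ ^ 3) + f ψ) * ((Fintype.card F : K) - 1)) := by
    rw [h, mul_sum, sum_congr rfl fun χ _ => key χ]
    have : ∀ χ, f χ * ((Fintype.card F : K) ^ 3 - (Fintype.card F : K) ^ 2 * Δ χ) =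
        (Fintype.card F : K) ^ 3 * f χ - (Fintype.card F : K) ^ 2 *
        (f χ * (if χ * 1 = 1 then (Fintype.card F : K) - 1 else 0) +
          f χ * (if χ * ψ = 1 then (Fintype.card F : K) - 1 else 0) +
          f χ * (if χ * ψ ^ 3 = 1 then (Fintype.card F : K) - 1 else 0)) := by
      intro χ
      simp only [Δ]
      ring
    simp only [this]
    rw [sum_sub_distrib, ← mul_sum, ← mul_sum, sum_add_distrib, sum_add_distrib,
      sum_mulChar_mul_ite, sum_mulChar_mul_ite, sum_mulChar_mul_ite, hi, hi3, inv_one]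
    ring
  have f1 : f 1 = - gaussSum (ψ ^ 2) e := by
    simp [f, gaussSum_one_of_isPrimitive he, MulChar.one_apply]
  have f3 : f (ψ ^ 3) = ψ (-1) * gaussSum (ψ ^ 3) e ^ 2 := by
    simp only [f]
    rw [hu _ (by rw [← pow_mul, show 3 * 4 = 4 * 3 from rfl, pow_mul, hψ4, one_pow]), hy3, hi3,
      ← pow_succ']
    ring
  have fψ : f ψ = ψ (-1) * gaussSum ψ e ^ 2 := by
    simp only [f]
    rw [hu _ hψ4, pow_two, inv_mul_cancel_left]
    ring
  simp only [f] at hsum f1 f3 fψ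
  rw [f1, f3, fψ, V] at hsum
  apply mul_left_cancel₀ hq1
  apply mul_left_cancel₀ (pow_ne_zero 2 hq)
  linear_combination ψ (-1) * hsum - ((Fintype.card F : K) ^ 2 * ((Fintype.card F : K) - 1) *
    (gaussSum (ψ ^ 2) e * torusSum (4 * u : F) ψ (ψ ^ 3) 1 1 +
      (gaussSum ψ e ^ 2 + gaussSum (ψ ^ 3) e ^ 2))) * y2

end EvaluationMixed

/-! ### Counting points by strata. -/

section PointCount

theorem smul_rep_injective {V : Type*} [AddCommGroup V] [Module F V] :
    Function.Injective fun p : Fˣ × ℙ F V => p.1 • p.2.rep := by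
  rintro ⟨a, P⟩ ⟨b, Q⟩ h
  simp only at h
  obtain rfl : P = Q := by
    rw [← P.mk_rep, ← Q.mk_rep, Projectivization.mk_eq_mk_iff]
    exact ⟨a⁻¹ * b, by rw [mul_smul, ← h, inv_smul_smul]⟩
  have : (a : F) = b := smul_left_injective F P.rep_nonzero h
  rw [Units.ext this]

theorem card_units_mul_ncard_dworkPoints (lam : F) :
    Fintype.card Fˣ * (dworkPoints lam).ncard =
      {v : Fin 4 → F | v ≠ 0 ∧ ∑ i, v i ^ 4 = 4 * lam * ∏ i, v i}.ncard := by
  have h1 : {v : Fin 4 → F | v ≠ 0 ∧ ∑ i, v i ^ 4 = 4 * lam * ∏ i, v i} =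
      (fun p : Fˣ × ℙ F (Fin 4 → F) => p.1 • p.2.rep) '' (Set.univ ×ˢ dworkPoints lam) := by
    ext v
    simp only [Set.mem_ofPred_eq, Set.mem_image, Set.mem_prod, Set.mem_univ, true_and, Prod.exists]
    constructor
    · rintro ⟨hv, h⟩
      obtain ⟨a, ha⟩ := Projectivization.exists_smul_eq_mk_rep F v hv
      exact ⟨a⁻¹, Projectivization.mk F v hv, (mk_mem_dworkPoints_iff lam v hv).mpr h,
        by rw [← ha, inv_smul_smul]⟩
    · rintro ⟨a, P, hP, rfl⟩
      have h0 : a • P.rep ≠ 0 := by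
        rw [Ne, smul_eq_zero_iff_eq]
        exact P.rep_nonzero
      refine ⟨h0, ?_⟩
      rw [← mk_mem_dworkPoints_iff lam _ h0]
      convert hP
      conv_rhs => rw [← P.mk_rep]
      rw [Projectivization.mk_eq_mk_iff]
      exact ⟨a, rfl⟩
  rw [h1, Set.ncard_image_of_injective _ smul_rep_injective, Set.ncard_prod, Set.ncard_univ,
    Nat.card_eq_fintype_card]

/-- Functions on `Fin 4` as quadruples. -/
def finFourArrowEquiv (α : Type*) : (Fin 4 → α) ≃ α × α × α × α where
  toFun v := (v 0, v 1, v 2, v 3)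
  invFun p := ![p.1, p.2.1, p.2.2.1, p.2.2.2]
  left_inv v := by ext i; fin_cases i <;> rfl
  right_inv p := rfl

/-- The extra 1 is the zero vector, which lies on the cone but gives no projective point. -/
theorem card_sub_one_mul_ncard_dworkPoints (lam : F) :
    ((Fintype.card F : K) - 1) * (dworkPoints lam).ncard + 1 =
      ∑ a : F, ∑ b : F, ∑ c : F, ∑ d : F,
        if a ^ 4 + b ^ 4 + c ^ 4 + d ^ 4 = 4 * lam * (a * b * c * d) then (1 : K) else 0 := by
  have h := congrArg (Nat.cast : ℕ → K) (card_units_mul_ncard_dworkPoints lam)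
  rw [Nat.cast_mul, cast_card_units] at h
  rw [h, Set.ncard_eq_toFinset_card', Set.toFinset_ofPred]
  have h1 : ∑ a : F, ∑ b : F, ∑ c : F, ∑ d : F,
      (if a ^ 4 + b ^ 4 + c ^ 4 + d ^ 4 = 4 * lam * (a * b * c * d) then (1 : K) else 0) =
      ∑ v : Fin 4 → F, if ∑ i, v i ^ 4 = 4 * lam * ∏ i, v i then (1 : K) else 0 := by
    rw [← (finFourArrowEquiv F).symm.sum_comp]
    simp only [Fintype.sum_prod_type, Fin.sum_univ_four, Fin.prod_univ_four]
    rfl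
  rw [h1, ← Finset.add_sum_erase _ _ (mem_univ (0 : Fin 4 → F)), add_comm, ← sum_filter,
    sum_const, nsmul_eq_mul, mul_one]
  congr 1
  · simp
  · congr 2
    ext v
    simp

/-- The strata have 2, 3 or 4 nonzero coordinates, in 6, 4 and 1 ways, besides the origin; one
nonzero coordinate is impossible. Homogeneity scales the first nonzero coordinate to 1. -/
theorem sum_dwork_eq (lam : F) :
    ∑ a : F, ∑ b : F, ∑ c : F, ∑ d : F,
        (if a ^ 4 + b ^ 4 + c ^ 4 + d ^ 4 = 4 * lam * (a * b * c * d) then (1 : K) else 0) =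
      1 + ((Fintype.card F : K) - 1) *
        (6 * (∑ b : Fˣ, if (1 : F) + b ^ 4 = 0 then 1 else 0) +
          4 * (∑ b : Fˣ, ∑ c : Fˣ, if (1 : F) + b ^ 4 + c ^ 4 = 0 then 1 else 0) +
          ∑ b : Fˣ, ∑ c : Fˣ, ∑ d : Fˣ,
            if (1 : F) + b ^ 4 + c ^ 4 + d ^ 4 = 4 * lam * (b * c * d) then 1 else 0) := by
  have s2 : ∑ a : Fˣ, ∑ b : Fˣ, (if (a : F) ^ 4 + b ^ 4 = 0 then (1 : K) else 0) =
      ((Fintype.card F : K) - 1) * ∑ b : Fˣ, if (1 : F) + b ^ 4 = 0 then 1 else 0 := by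
    rw [← cast_card_units, ← nsmul_eq_mul, ← card_univ, ← sum_const]
    refine sum_congr rfl fun a _ => ?_
    rw [← Equiv.sum_comp (Equiv.mulLeft a)]
    refine sum_congr rfl fun b _ => ?_
    refine if_congr ?_ rfl rfl
    have : (a : F) ^ 4 + (a * b) ^ 4 = a ^ 4 * (1 + b ^ 4) := by ring
    simp [this]
  have s3 : ∑ a : Fˣ, ∑ b : Fˣ, ∑ c : Fˣ, (if (a : F) ^ 4 + b ^ 4 + c ^ 4 = 0 then (1 : K) else 0) =
      ((Fintype.card F : K) - 1) *
        ∑ b : Fˣ, ∑ c : Fˣ, if (1 : F) + b ^ 4 + c ^ 4 = 0 then 1 else 0 := by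
    rw [← cast_card_units, ← nsmul_eq_mul, ← card_univ, ← sum_const]
    refine sum_congr rfl fun a _ => ?_
    rw [← Equiv.sum_comp (Equiv.mulLeft a)]
    refine sum_congr rfl fun b _ => ?_
    rw [← Equiv.sum_comp (Equiv.mulLeft a)]
    refine sum_congr rfl fun c _ => ?_
    refine if_congr ?_ rfl rfl
    have : (a : F) ^ 4 + (a * b) ^ 4 + (a * c) ^ 4 = a ^ 4 * (1 + b ^ 4 + c ^ 4) := by ring
    simp [this]
  have s4 : ∑ a : Fˣ, ∑ b : Fˣ, ∑ c : Fˣ, ∑ d : Fˣ,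
      (if (a : F) ^ 4 + b ^ 4 + c ^ 4 + d ^ 4 = 4 * lam * (a * b * c * d) then (1 : K) else 0) =
      ((Fintype.card F : K) - 1) * ∑ b : Fˣ, ∑ c : Fˣ, ∑ d : Fˣ,
        if (1 : F) + b ^ 4 + c ^ 4 + d ^ 4 = 4 * lam * (b * c * d) then 1 else 0 := by
    rw [← cast_card_units, ← nsmul_eq_mul, ← card_univ, ← sum_const]
    refine sum_congr rfl fun a _ => ?_
    rw [← Equiv.sum_comp (Equiv.mulLeft a)]
    refine sum_congr rfl fun b _ => ?_
    rw [← Equiv.sum_comp (Equiv.mulLeft a)]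
    refine sum_congr rfl fun c _ => ?_
    rw [← Equiv.sum_comp (Equiv.mulLeft a)]
    refine sum_congr rfl fun d _ => ?_
    refine if_congr ?_ rfl rfl
    simp only [Equiv.coe_mulLeft, Units.val_mul]
    have h1 : (a : F) ^ 4 + (a * b) ^ 4 + (a * c) ^ 4 + (a * d) ^ 4 =
        a ^ 4 * (1 + b ^ 4 + c ^ 4 + d ^ 4) := by ring
    have h2 : 4 * lam * ((a : F) * (a * b) * (a * c) * (a * d)) =
        a ^ 4 * (4 * lam * (b * c * d)) := by ring
    rw [h1, h2, mul_right_inj' (pow_ne_zero 4 a.ne_zero)]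
  rw [mul_add, mul_add, ← s4, mul_left_comm _ (4 : K), ← s3, mul_left_comm _ (6 : K), ← s2]
  simp only [sum_eq_zero_add_sum_units (F := F) (M := K), sum_add_distrib]
  simp only [ne_eq, OfNat.ofNat_ne_zero, not_false_eq_true, zero_pow, zero_mul, mul_zero, zero_add,
    add_zero, if_true, pow_eq_zero_iff, Units.ne_zero, if_false, sum_const_zero]
  ring

variable [IsAlgClosed K] [CharZero K]

theorem sum_units_one_add_pow_four {ψ : MulChar F K} (hψ : orderOf ψ = 4) :
    (∑ b : Fˣ, if (1 : F) + b ^ 4 = 0 then (1 : K) else 0) = 2 + 2 * ψ (-1) := by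
  have := Fintype.ofFinite (MulChar F K)
  have h := sum_units_pow_orderOf (by norm_num) hψ
    (fun y : Fˣ => if (1 : F) + y = 0 then (1 : K) else 0)
  simp only [Units.val_pow_eq_pow_val] at h
  rw [h, Fintype.sum_eq_single (-1)]
  · have y2 := ψ.apply_neg_one_mul_self
    simp [sum_range_succ, MulChar.pow_apply', MulChar.one_apply]
    linear_combination (ψ (-1) + 1) * y2
  · intro y hy
    rw [if_neg, zero_mul]
    intro h
    apply hy
    rw [← Units.val_inj]
    push_cast
    linear_combination h

theorem sum_sum_units_pow_orderOf {ρ : MulChar F K} {n : ℕ} (hn : 0 < n)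
    (hρ : orderOf ρ = n) (f : Fˣ → Fˣ → K) :
    ∑ b : Fˣ, ∑ c : Fˣ, f (b ^ n) (c ^ n) = ∑ i ∈ range n, ∑ j ∈ range n,
      ∑ y : Fˣ, ∑ z : Fˣ, f y z * ((ρ ^ i) y * (ρ ^ j) z) := by
  have := Fintype.ofFinite (MulChar F K)
  calc ∑ b : Fˣ, ∑ c : Fˣ, f (b ^ n) (c ^ n)
      = ∑ b : Fˣ, ∑ z : Fˣ, f (b ^ n) z * ∑ j ∈ range n, (ρ ^ j) z :=
        sum_congr rfl fun b _ => sum_units_pow_orderOf hn hρ (f (b ^ n))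
    _ = ∑ y : Fˣ, (∑ z : Fˣ, f y z * ∑ j ∈ range n, (ρ ^ j) z) * ∑ i ∈ range n, (ρ ^ i) y :=
        sum_units_pow_orderOf hn hρ fun y => ∑ z : Fˣ, f y z * ∑ j ∈ range n, (ρ ^ j) z
    _ = ∑ y : Fˣ, ∑ z : Fˣ, ∑ i ∈ range n, ∑ j ∈ range n, f y z * ((ρ ^ i) y * (ρ ^ j) z) := by
        refine sum_congr rfl fun y _ => ?_
        rw [sum_mul]
        refine sum_congr rfl fun z _ => ?_
        simp only [← mul_sum, ← sum_mul]
        ring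
    _ = ∑ y : Fˣ, ∑ i ∈ range n, ∑ j ∈ range n, ∑ z : Fˣ, f y z * ((ρ ^ i) y * (ρ ^ j) z) := by
        refine sum_congr rfl fun y _ => ?_
        rw [sum_comm]
        exact sum_congr rfl fun i _ => sum_comm
    _ = _ := by
        rw [sum_comm]
        exact sum_congr rfl fun i _ => sum_comm

theorem sum_units_mul_apply_eq_jacobiSum (A B : MulChar F K) :
    ∑ y : Fˣ, ∑ z : Fˣ, (if (1 : F) + y + z = 0 then A y * B z else 0) =
      (A * B) (-1) * jacobiSum A B := by
  have h1 : ∀ y : Fˣ, ∑ z : Fˣ, (if (1 : F) + y + z = 0 then A y * B z else 0) =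
      A y * B (-1 - (y : F)) := by
    intro y
    have h := sum_eq_zero_add_sum_units (fun z : F => if (1 : F) + y + z = 0 then A y * B z else 0)
    simp only [MulChar.map_zero, mul_zero, ite_self, zero_add] at h
    rw [← h, Fintype.sum_eq_single (-1 - (y : F))]
    · rw [if_pos (by ring)]
    · intro z hz
      rw [if_neg]
      intro h
      apply hz
      linear_combination h
  rw [sum_congr rfl fun y _ => h1 y, jacobiSum, MulChar.sum_units_eq A fun x => B (1 - x),
    ← Equiv.sum_comp (Equiv.neg Fˣ), mul_sum]
  refine sum_congr rfl fun y _ => ?_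
  rw [Equiv.neg_apply, Units.val_neg, ← neg_one_mul, map_mul, MulChar.mul_apply,
    show (-1 - -1 * (y : F)) = -1 * (1 - y) by ring, map_mul]
  ring

theorem sum_units_one_add_pow_four_add_pow_four {ψ : MulChar F K} (hψ : orderOf ψ = 4) :
    (∑ b : Fˣ, ∑ c : Fˣ, if (1 : F) + b ^ 4 + c ^ 4 = 0 then (1 : K) else 0) =
      Fintype.card F - 5 - 6 * ψ (-1) + 3 * (jacobiSum ψ ψ + jacobiSum (ψ ^ 3) (ψ ^ 3)) := by
  have := Fintype.ofFinite (MulChar F K)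
  have h : (∑ b : Fˣ, ∑ c : Fˣ, if (1 : F) + b ^ 4 + c ^ 4 = 0 then (1 : K) else 0) =
      ∑ i ∈ range 4, ∑ j ∈ range 4, (ψ ^ i * ψ ^ j) (-1) * jacobiSum (ψ ^ i) (ψ ^ j) := by
    simp only [← sum_units_mul_apply_eq_jacobiSum]
    have h1 := sum_sum_units_pow_orderOf (by norm_num) hψ
      (fun y z : Fˣ => if (1 : F) + y + z = 0 then (1 : K) else 0)
    simpa only [Units.val_pow_eq_pow_val, ite_mul, one_mul, zero_mul] using h1
  rw [h]
  have hψ4 := pow_four_of_orderOf_eq_four hψ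
  have hφ := orderOf_sq_of_orderOf_eq_four hψ
  have hψ1 := ne_one_of_orderOf_eq_four hψ
  have hφ1 : ψ ^ 2 ≠ 1 := by intro h; rw [h] at hφ; simp at hφ
  have hi : ψ⁻¹ = ψ ^ 3 := inv_eq_of_mul_eq_one_right (by rw [← pow_succ', hψ4])
  have hi2 : (ψ ^ 2)⁻¹ = ψ ^ 2 := inv_eq_of_mul_eq_one_right (by rw [← pow_add, hψ4])
  have h31 : ψ ^ 3 ≠ 1 := by rw [← hi]; simpa using hψ1
  have y2 := ψ.apply_neg_one_mul_self
  -- Duplication leaves J(ψ,ψ) and J(ψ³,ψ³) as the only Jacobi sums not evaluated outright.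
  have j12 : jacobiSum ψ (ψ ^ 2) = ψ (-1) * jacobiSum ψ ψ := by
    rw [← apply_four_mul_jacobiSum_self hφ hψ1, MulChar.apply_four_of_orderOf_eq_four hψ]
  have j32 : jacobiSum (ψ ^ 3) (ψ ^ 2) = ψ (-1) * jacobiSum (ψ ^ 3) (ψ ^ 3) := by
    rw [← apply_four_mul_jacobiSum_self hφ h31, MulChar.pow_apply' _ (by norm_num),
      MulChar.apply_four_of_orderOf_eq_four hψ]
    linear_combination ψ (-1) * jacobiSum (ψ ^ 3) (ψ ^ 3) * y2
  have j13 : jacobiSum ψ (ψ ^ 3) = - ψ (-1) := by rw [← hi, jacobiSum_nontrivial_inv hψ1]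
  have j22 : jacobiSum (ψ ^ 2) (ψ ^ 2) = - 1 := by
    have := jacobiSum_nontrivial_inv hφ1
    rwa [hi2, sq_apply_neg_one] at this
  have u1 : IsUnit (-1 : F) := by simp
  simp only [sum_range_succ, sum_range_zero, zero_add, pow_zero, pow_one, MulChar.mul_apply,
    MulChar.one_apply u1, jacobiSum_one_one, jacobiSum_one_nontrivial hψ1,
    jacobiSum_one_nontrivial hφ1, jacobiSum_one_nontrivial h31, jacobiSum_comm _ (1 : MulChar F K),
    jacobiSum_comm (ψ ^ 2) ψ, jacobiSum_comm (ψ ^ 3) ψ, jacobiSum_comm (ψ ^ 2) (ψ ^ 3),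
    j12, j32, j13, j22, sq_apply_neg_one, MulChar.pow_apply' ψ (show 3 ≠ 0 by norm_num)]
  generalize ψ (-1) = y at *
  have y2' : y ^ 2 = 1 := by linear_combination y2
  have y3 : y ^ 3 = y := by linear_combination y * y2
  simp only [y3]
  ring_nf
  simp only [y3, y2']
  ring


theorem sum_rotate {α M : Type*} [Fintype α] [AddCommMonoid M] (f : α → α → α → M) :
    ∑ a, ∑ b, ∑ c, f a b c = ∑ c, ∑ a, ∑ b, f a b c :=
  (sum_congr rfl fun _ _ => sum_comm).trans sum_comm

/-- The change of variables is a = y/w, b = z/w, c = w³/(yz), d = 1/w: the product is 1, and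
dividing the equation by w gives a + b + c + d = s. -/
theorem sum_torus_eq_torusSum (s : F) (A B : MulChar F K) :
    ∑ w : Fˣ, ∑ y : Fˣ, ∑ z : Fˣ,
      (if (1 : F) + y + z + w ^ 4 * (y⁻¹ * z⁻¹ : Fˣ) = s * w then A y * B z else 0) =
      torusSum s A B 1 (A * B)⁻¹ := by
  have h1 : torusSum s A B 1 (A * B)⁻¹ = ∑ d : Fˣ, ∑ a : Fˣ, ∑ b : Fˣ,
      if (a + b + (a * b * d)⁻¹ + d : F) = s then A a * B b * (A * B)⁻¹ d else 0 := by
    refine Eq.trans ?_ (sum_rotate _)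
    rw [torusSum]
    refine sum_congr rfl fun a _ => sum_congr rfl fun b _ => ?_
    rw [sum_comm]
    refine sum_congr rfl fun d _ => ?_
    rw [Fintype.sum_eq_single (a * b * d)⁻¹]
    · refine if_congr ?_ (by rw [MulChar.one_apply_coe, mul_one]) rfl
      rw [and_iff_right (by rw [mul_right_comm, mul_inv_cancel])]
    · intro c hc
      rw [if_neg]
      rintro ⟨h, -⟩
      apply hc
      rw [eq_inv_iff_mul_eq_one, ← h]
      ac_rfl
  rw [h1, ← Equiv.sum_comp (Equiv.inv Fˣ)]
  refine sum_congr rfl fun w _ => ?_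
  rw [← Equiv.sum_comp (Equiv.mulLeft w⁻¹)]
  refine sum_congr rfl fun a _ => ?_
  rw [← Equiv.sum_comp (Equiv.mulLeft w⁻¹)]
  refine sum_congr rfl fun b _ => ?_
  simp only [Equiv.inv_apply, Equiv.coe_mulLeft]
  refine if_congr ?_ ?_ rfl
  · rw [← mul_right_inj' w.ne_zero]
    push_cast
    have hw := w.ne_zero
    have ha := a.ne_zero
    have hb := b.ne_zero
    refine Eq.congr ?_ ?_
    · field_simp
      ring
    · field_simp
  · simp only [Units.val_mul, map_mul, MulChar.mul_apply, MulChar.inv_apply', Units.val_inv_eq_inv_val]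
    ring

theorem sum_units_eq_sum_torusSum {ψ : MulChar F K} (hψ : orderOf ψ = 4) (lam : F) :
    (∑ b : Fˣ, ∑ c : Fˣ, ∑ d : Fˣ,
      if (1 : F) + b ^ 4 + c ^ 4 + d ^ 4 = 4 * lam * (b * c * d) then (1 : K) else 0) =
      ∑ i ∈ range 4, ∑ j ∈ range 4, torusSum (4 * lam) (ψ ^ i) (ψ ^ j) 1 (ψ ^ i * ψ ^ j)⁻¹ := by
  have h1 : (∑ b : Fˣ, ∑ c : Fˣ, ∑ d : Fˣ,
      if (1 : F) + b ^ 4 + c ^ 4 + d ^ 4 = 4 * lam * (b * c * d) then (1 : K) else 0) =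
      ∑ w : Fˣ, ∑ b : Fˣ, ∑ c : Fˣ,
        if (1 : F) + (b ^ 4 : Fˣ) + (c ^ 4 : Fˣ) + w ^ 4 * ((b ^ 4)⁻¹ * (c ^ 4)⁻¹ : Fˣ) =
          4 * lam * w then (1 : K) else 0 := by
    refine Eq.trans ?_ (sum_rotate _)
    refine sum_congr rfl fun b _ => sum_congr rfl fun c _ => ?_
    -- The new variable is w = bcd, after which `b` and `c` occur only as fourth powers.
    rw [← Equiv.sum_comp (Equiv.mulRight (b⁻¹ * c⁻¹))]
    refine sum_congr rfl fun w _ => if_congr ?_ rfl rfl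
    simp only [Equiv.coe_mulRight]
    push_cast
    have hb := b.ne_zero
    have hc := c.ne_zero
    refine Eq.congr ?_ ?_ <;> field_simp
  have h2 := fun w : Fˣ => sum_sum_units_pow_orderOf (by norm_num) hψ fun y z : Fˣ =>
    if (1 : F) + y + z + w ^ 4 * (y⁻¹ * z⁻¹ : Fˣ) = 4 * lam * w then (1 : K) else 0
  rw [h1, sum_congr rfl fun w _ => h2 w, sum_comm]
  refine sum_congr rfl fun i _ => ?_
  rw [sum_comm]
  refine sum_congr rfl fun j _ => ?_
  rw [← sum_torus_eq_torusSum]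
  simp only [ite_mul, one_mul, zero_mul]

end PointCount

/-! ### Symmetries of the torus sums. -/

section TorusSymmetry

theorem torusSum_swap_left (s : F) (A B C D : MulChar F K) :
    torusSum s A B C D = torusSum s B A C D := by
  rw [torusSum, sum_comm]
  refine sum_congr rfl fun b _ => sum_congr rfl fun a _ => sum_congr rfl fun c _ =>
    sum_congr rfl fun d _ => ?_
  rw [mul_comm (A a), mul_comm a, add_comm (a : F)]

theorem torusSum_swap_middle (s : F) (A B C D : MulChar F K) :
    torusSum s A B C D = torusSum s A C B D := by
  rw [torusSum]
  refine sum_congr rfl fun a _ => ?_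
  rw [sum_comm]
  refine sum_congr rfl fun c _ => sum_congr rfl fun b _ => sum_congr rfl fun d _ => ?_
  rw [mul_right_comm (A a), mul_right_comm a, add_right_comm (a : F)]

theorem torusSum_swap_right (s : F) (A B C D : MulChar F K) :
    torusSum s A B C D = torusSum s A B D C := by
  rw [torusSum]
  refine sum_congr rfl fun a _ => sum_congr rfl fun b _ => ?_
  rw [sum_comm]
  refine sum_congr rfl fun d _ => sum_congr rfl fun c _ => ?_
  rw [mul_right_comm (A a * B b), mul_right_comm (a * b), add_right_comm (a + b : F)]

theorem torusSum_mul_left (s : F) (A B C D ρ : MulChar F K) :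
    torusSum s (ρ * A) (ρ * B) (ρ * C) (ρ * D) = torusSum s A B C D := by
  refine sum_congr rfl fun a _ => sum_congr rfl fun b _ => sum_congr rfl fun c _ =>
    sum_congr rfl fun d _ => ?_
  split_ifs with h
  · have h1 : ρ (a * b * c * d : Fˣ) = 1 := by rw [h.1, Units.val_one, map_one]
    simp only [Units.val_mul, map_mul] at h1
    simp only [MulChar.mul_apply]
    linear_combination A a * B b * C c * D d * h1
  · rfl

/-- The exponent quadruples modulo 4 have sum zero and third entry zero; up to permutation and a
common shift they fall into three orbits, met 1, 3 and 12 times. -/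
theorem sum_torusSum_of_orderOf_eq_four {ψ : MulChar F K} (hψ : orderOf ψ = 4) (s : F) :
    ∑ i ∈ range 4, ∑ j ∈ range 4, torusSum s (ψ ^ i) (ψ ^ j) 1 (ψ ^ i * ψ ^ j)⁻¹ =
      torusSum s (1 : MulChar F K) 1 1 1 + 3 * torusSum s 1 1 (ψ ^ 2) (ψ ^ 2) +
        12 * torusSum s ψ (ψ ^ 3) 1 1 := by
  have hψ4 := pow_four_of_orderOf_eq_four hψ
  let t : ZMod 4 → ZMod 4 → ZMod 4 → ZMod 4 → K := fun i j k l =>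
    torusSum s (ψ ^ i.val) (ψ ^ j.val) (ψ ^ k.val) (ψ ^ l.val)
  have e12 : ∀ i j k l, t i j k l = t j i k l := fun i j k l => torusSum_swap_left _ _ _ _ _
  have e23 : ∀ i j k l, t i j k l = t i k j l := fun i j k l => torusSum_swap_middle _ _ _ _ _
  have e34 : ∀ i j k l, t i j k l = t i j l k := fun i j k l => torusSum_swap_right _ _ _ _ _
  have hm : ∀ n, ψ ^ (n % 4) = ψ ^ n := fun n => by rw [← hψ, pow_mod_orderOf]
  have shift : ∀ i j k l, t i j k l = t (1 + i) (1 + j) (1 + k) (1 + l) := by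
    intro i j k l
    simp only [t, ZMod.val_add, hm, pow_add, torusSum_mul_left]
  have h : ∀ i j : ℕ, torusSum s (ψ ^ i) (ψ ^ j) 1 (ψ ^ i * ψ ^ j)⁻¹ =
      t i j 0 (-(i + j : ℕ)) := by
    intro i j
    simp only [t, ZMod.val_natCast, hm, ZMod.val_zero, pow_zero]
    congr 1
    rw [← pow_add, inv_eq_iff_mul_eq_one, ← hm (i + j), ← ZMod.val_natCast, ← pow_add, ← hm,
      ← ZMod.val_add, add_neg_cancel, ZMod.val_zero, pow_zero]
  have h1 : torusSum s ψ (ψ ^ 3) 1 1 = t 1 3 0 0 := by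
    simp only [t, ZMod.val_zero, pow_zero, show (1 : ZMod 4).val = 1 from rfl,
      show (3 : ZMod 4).val = 3 from rfl, pow_one]
  have h2 : torusSum s (1 : MulChar F K) 1 (ψ ^ 2) (ψ ^ 2) = t 0 0 2 2 := by
    simp only [t, ZMod.val_zero, pow_zero, show (2 : ZMod 4).val = 2 from rfl]
  have h0 : torusSum s (1 : MulChar F K) 1 1 1 = t 0 0 0 0 := by
    simp only [t, ZMod.val_zero, pow_zero]
  have a01 : t 0 1 0 3 = t 1 3 0 0 := by rw [e12, e34, e23]
  have a02 : t 0 2 0 2 = t 0 0 2 2 := by rw [e23]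
  have a03 : t 0 3 0 1 = t 1 3 0 0 := by rw [e34, e23, e12, e23, e12]
  have a10 : t 1 0 0 3 = t 1 3 0 0 := by rw [e34, e23]
  have a11 : t 1 1 0 2 = t 1 3 0 0 := by
    rw [shift, shift, shift]
    change t 0 0 3 1 = _
    rw [e34, e23, e12, e34, e23]
  have a12 : t 1 2 0 1 = t 1 3 0 0 := by
    rw [shift, shift, shift]
    change t 0 1 3 0 = _
    rw [e12, e23]
  have a20 : t 2 0 0 2 = t 0 0 2 2 := by rw [e12, e23]
  have a21 : t 2 1 0 1 = t 1 3 0 0 := by rw [e12, a12]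
  have a22 : t 2 2 0 0 = t 0 0 2 2 := by
    rw [shift, shift]
    rfl
  have a23 : t 2 3 0 3 = t 1 3 0 0 := by
    rw [shift]
    change t 3 0 1 0 = _
    rw [e23, e12]
  have a30 : t 3 0 0 1 = t 1 3 0 0 := by rw [e34, e23, e12]
  have a31 : t 3 1 0 0 = t 1 3 0 0 := by rw [e12]
  have a32 : t 3 2 0 3 = t 1 3 0 0 := by rw [e12, a23]
  have a33 : t 3 3 0 2 = t 1 3 0 0 := by
    rw [shift]
    change t 0 0 1 3 = _
    rw [e23, e12, e34, e23]
  simp only [h, h0, h1, h2, sum_range_succ, sum_range_zero, zero_add]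
  change t 0 0 0 0 + t 0 1 0 3 + t 0 2 0 2 + t 0 3 0 1 + (t 1 0 0 3 + t 1 1 0 2 + t 1 2 0 1 + t 1 3 0 0)
    + (t 2 0 0 2 + t 2 1 0 1 + t 2 2 0 0 + t 2 3 0 3)
    + (t 3 0 0 1 + t 3 1 0 0 + t 3 2 0 3 + t 3 3 0 2) = _
  rw [a01, a02, a03, a10, a11, a12, a20, a21, a22, a23, a30, a31, a32, a33]
  ring

end TorusSymmetry

/-! ### Assembly and the special fibres. -/

section Main

variable [IsAlgClosed K] [CharZero K]

/-- A primitive character exists over a cyclotomic extension of `K`, which maps back into the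
algebraically closed `K`. -/
theorem exists_isPrimitive_addChar : ∃ e : AddChar F K, e.IsPrimitive := by
  have hF : ringChar K ≠ ringChar F := by
    rw [ringChar.eq_zero (R := K)]
    exact (CharP.ringChar_ne_zero_of_finite F).symm
  let p := AddChar.FiniteField.primitiveChar F K hF
  have hn : (p.n : ℕ) ≠ 0 := p.n.ne_zero
  have : NeZero ((p.n : ℕ) : K) := ⟨by exact_mod_cast hn⟩
  have : FiniteDimensional K (CyclotomicField p.n K) :=
    IsCyclotomicExtension.finiteDimensional {(p.n : ℕ)} K _
  have : Algebra.IsAlgebraic K (CyclotomicField p.n K) := Algebra.IsAlgebraic.of_finite _ _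
  let c : CyclotomicField p.n K →ₐ[K] K := IsAlgClosed.lift
  refine ⟨c.toMonoidHom.compAddChar p.char, ?_⟩
  exact p.prim.compMulHom_of_isPrimitive (c.toRingHom.injective)

theorem ncard_dworkPoints_eq {ψ : MulChar F K} (hψ : orderOf ψ = 4) (u : Fˣ) :
    ((dworkPoints (u : F)).ncard : K) =
      (Fintype.card F : K) ^ 2 + Fintype.card F + 1 +
        12 * (Fintype.card F : K) * ψ (-1) * (ψ ^ 2) (1 - (u : F) ^ 4) +
        (Fintype.card F : K) ^ 2 * greeneHyp ![ψ, ψ ^ 2, ψ ^ 3] ![1, 1] (1 / (u : F) ^ 4) +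
        3 * (Fintype.card F : K) ^ 2 * greeneBinom (ψ ^ 3) ψ *
          greeneHyp ![ψ ^ 3, ψ] ![ψ ^ 2] (1 / (u : F) ^ 4) := by
  obtain ⟨e, he⟩ := exists_isPrimitive_addChar (F := F) (K := K)
  have hq := cast_card_ne_zero (F := F) (K := K)
  have hq1 := cast_card_sub_one_ne_zero (F := F) (K := K)
  have hg := gaussSum_ne_zero he (ψ ^ 2)
  have hψ4 := pow_four_of_orderOf_eq_four hψ
  have hφ := orderOf_sq_of_orderOf_eq_four hψ
  have hφ1 : ψ ^ 2 ≠ 1 := by intro h; rw [h] at hφ; simp at hφ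
  have h := card_sub_one_mul_ncard_dworkPoints (K := K) (u : F)
  rw [sum_dwork_eq, sum_units_one_add_pow_four hψ, sum_units_one_add_pow_four_add_pow_four hψ,
    sum_units_eq_sum_torusSum hψ, sum_torusSum_of_orderOf_eq_four hψ] at h
  have t1 := torusSum_one_eq_greeneHyp he hψ u
  have t2 := torusSum_sq_eq_greeneHyp he hψ u
  have t3 := torusSum_cube_eq_gaussSum he hψ u
  have j1 := jacobiSum_mul_nontrivial (χ := ψ) (φ := ψ) (by rwa [← pow_two]) e
  have h33 : ψ ^ 3 * ψ ^ 3 = ψ ^ 2 := by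
    rw [← pow_add, show 3 + 3 = 4 + 2 from rfl, pow_add, hψ4, one_mul]
  have j3 := jacobiSum_mul_nontrivial (χ := ψ ^ 3) (φ := ψ ^ 3) (by rwa [h33]) e
  rw [h33] at j3
  rw [← pow_two ψ] at j1
  apply mul_left_cancel₀ hq1
  apply mul_left_cancel₀ hq
  apply mul_left_cancel₀ hg
  rw [t2] at h
  linear_combination (Fintype.card F : K) * gaussSum (ψ ^ 2) e * h +
    (Fintype.card F - 1) * gaussSum (ψ ^ 2) e * t1 +
    12 * Fintype.card F * (Fintype.card F - 1) * t3 +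
    12 * Fintype.card F * (Fintype.card F - 1) * (j1 + j3)

/-- At argument 1 the Gauss sum series is φ(2)g(φ) up to the factor q - 1, and φ(2) = ψ(4) = ψ(-1).
-/
theorem greeneBinom_mul_greeneHyp_two_one_one {ψ : MulChar F K} (hψ : orderOf ψ = 4) :
    (Fintype.card F : K) ^ 2 * greeneBinom (ψ ^ 3) ψ * greeneHyp ![ψ ^ 3, ψ] ![ψ ^ 2] 1 =
      Fintype.card F * ψ (-1) := by
  obtain ⟨e, he⟩ := exists_isPrimitive_addChar (F := F) (K := K)
  have := Fintype.ofFinite (MulChar F K)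
  have hφ := orderOf_sq_of_orderOf_eq_four hψ
  have h := greeneBinom_mul_greeneHyp_two_one he hψ 1
  have h1 := sum_gaussSum_sq_mul_gaussSum e hφ
  simp only [Units.val_one, one_pow, div_one, map_one, one_mul] at h
  rw [h1] at h
  have s := gaussSum_sq_of_orderOf_eq_four he hψ
  have h2 : (ψ ^ 2) 2 = ψ (-1) := by
    rw [MulChar.pow_apply' _ two_ne_zero, ← map_pow, ← MulChar.apply_four_of_orderOf_eq_four hψ]
    norm_num
  rw [h2] at h
  apply mul_left_cancel₀ (cast_card_sub_one_ne_zero (F := F) (K := K))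
  linear_combination h + ((Fintype.card F : K) - 1) * ψ (-1) * s

end Main

end DworkSurface

theorem theorem1p1 {F K : Type*} [Field F] [Fintype F] [Field K] [IsAlgClosed K] [CharZero K]
    (hq : Fintype.card F % 4 = 1) (t : ℕ) (ht : t = (Fintype.card F - 1) / 4)
    (T : MulChar F K) (hT : ∀ χ : MulChar F K, χ ∈ Subgroup.zpowers T)
    (lam : F) :
    (lam ^ 4 = 1 →
      ((dworkPoints lam).ncard : K) =
        ((Fintype.card F : K) ^ 3 - 1) / ((Fintype.card F : K) - 1)
          + 3 * (Fintype.card F : K) * (T ^ t) (-1)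
          + (Fintype.card F : K) ^ 2 *
              greeneHyp ![T ^ t, T ^ (2 * t), T ^ (3 * t)] ![1, 1] 1) ∧
    (lam ≠ 0 →
      ((dworkPoints lam).ncard : K) =
        ((Fintype.card F : K) ^ 3 - 1) / ((Fintype.card F : K) - 1)
          + 12 * (Fintype.card F : K) * (T ^ t) (-1) * (T ^ (2 * t)) (1 - lam ^ 4)
          + (Fintype.card F : K) ^ 2 *
              greeneHyp ![T ^ t, T ^ (2 * t), T ^ (3 * t)] ![1, 1] (1 / lam ^ 4)
          + 3 * (Fintype.card F : K) ^ 2 * greeneBinom (T ^ (3 * t)) (T ^ t) *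
              greeneHyp ![T ^ (3 * t), T ^ t] ![T ^ (2 * t)] (1 / lam ^ 4)) := by
  classical
  have hq1 := cast_card_sub_one_ne_zero (F := F) (K := K)
  have hcard := Fintype.one_lt_card (α := F)
  have hT4 : orderOf T = Fintype.card F - 1 := by
    rw [orderOf_eq_card_of_forall_mem_zpowers hT, MulChar.card_eq_card_sub_one]
  have hψ : orderOf (T ^ t) = 4 := by
    have h4 : orderOf T = 4 * t := by omega
    rw [orderOf_pow_of_dvd (by omega) (by rw [h4]; exact Dvd.intro_left 4 rfl), h4]
    exact Nat.mul_div_cancel 4 (by omega)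
  rw [mul_comm 2 t, mul_comm 3 t, pow_mul, pow_mul]
  generalize T ^ t = ψ at *
  have hgeom : ((Fintype.card F : K) ^ 3 - 1) / ((Fintype.card F : K) - 1) =
      (Fintype.card F : K) ^ 2 + Fintype.card F + 1 := by
    rw [div_eq_iff hq1]
    ring
  rw [hgeom]
  refine ⟨fun h => ?_, fun h => ncard_dworkPoints_eq hψ (Units.mk0 lam h)⟩
  have h0 : lam ≠ 0 := by rintro rfl; simp at h
  have h1 := ncard_dworkPoints_eq hψ (Units.mk0 lam h0)
  have h2 := greeneBinom_mul_greeneHyp_two_one_one hψ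
  -- The term with coefficient 12 dies because characters vanish at 0; the coefficient 3 in the
  -- result comes from the ₂F₁ at 1.
  rw [Units.val_mk0, h, sub_self, MulChar.map_zero, div_one] at h1
  linear_combination h1 + 3 * h2
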